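/- **Setting.** Let $S$ be a closed oriented surface (a compact Hausdorff 2-manifold with an oriented atlas; smoothness is not needed). A *measured foliation* $(\mathcal F,\mu)$ on $S$ is given, outside a set of singularities, by charts $(x,y)$ whose changes are locally of the form $(x,y)\mapsto(h(x,y),\pm y+c)$; its leaves are locally $\{y=\mathrm{const}\}$ and its transverse measure is $|dy|$. At each singularity there are an integer $k\ge 1$, $k\ne 2$ (the case $k=1$, a spine, is allowed), and a centred coordinate $z$ in which the leaves are locally $\{\operatorname{Im} z^{k/2}=\mathrm{const}\}$ and the transverse measure is $|d\operatorname{Im} z^{k/2}|$. Two measured foliations are *transverse* if they have the same singularities and, near each point, they are given in a common coordinate by the imaginary and the real part, respectively, of $z$ (near a regular point) or of $z^{k/2}$ (near a singularity). An orientation-preserving homeomorphism $f:S\to S$ is a *(generalized) pseudo-Anosov, or p-A, homeomorphism* if there are $\lambda>1$ and transverse $f$-invariant measured foliations $(\mathcal F^s,\mu^s)$ and $(\mathcal F^u,\mu^u)$ such that $\mu^s(f(\alpha))=\lambda\,\mu^s(\alpha)$ for arcs $\alpha$ transverse to $\mathcal F^s$, and $\mu^u(f(\alpha))=\lambda^{-1}\mu^u(\alpha)$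 for arcs $\alpha$ transverse to $\mathcal F^u$. Let $\mathrm{Sing}(f)$ be the common set of singularities of the foliations if it is non-empty, and otherwise a chosen finite set of periodic points of $f$. A *stable* (*unstable*) *separatrix* of $p\in \mathrm{Sing}(f)$ is a leaf of the restriction of $\mathcal F^s$ ($\mathcal F^u$) to $S\setminus \mathrm{Sing}(f)$ which is an injectively parametrized ray starting at $p$. For $z$ on it, $(p,z]^s$ (respectively $(p,z]^u$) is the interval of the separatrix between $p$ and $z$, with $p$ excluded and $z$ included. A point $z\in S\setminus \mathrm{Sing}(f)$ is a *first intersection point* of $f$ if there are $p,q\in\mathrm{Sing}(f)$, a stable separatrix of $p$ and an unstable separatrix of $q$, both containing $z$, with $$(p,z]^s\cap(q,z]^u=\{z\}.$$ **Proposition.** Let $f$ be a p-A homeomorphism of $S$, with foliations and set $\mathrm{Sing}(f)$ as above. Then the set of orbits $\{f^n(z):n\in\mathbb Z\}$ of first intersection points $z$ of $f$ is finite. -/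

import Mathlib

open Set Filter Topology

noncomputable section

namespace PA

/-! ### Oriented surfaces -/

/-- A map of the plane, injective near `z`, preserves the orientation at `z`: the image of every
small positively oriented circle around `z` winds exactly once, positively, around `h z`. Here
`θ` is a continuous choice of the argument of `h (z + r * exp (i t)) - h z`. -/
def PreservesOrientationAt (h : ℂ → ℂ) (z : ℂ) : Prop :=
  ∀ᶠ r : ℝ in 𝓝[>] 0, ∃ θ : ℝ → ℝ, Continuous θ ∧ θ (2 * Real.pi) = θ 0 + 2 * Real.pi ∧
    ∀ t : ℝ, h (z + r * Complex.exp (t * Complex.I)) - h z =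
      (‖h (z + r * Complex.exp (t * Complex.I)) - h z‖ : ℂ) * Complex.exp (θ t * Complex.I)

/-- The atlas of the surface `S` is oriented: all changes of charts preserve the orientation of
the plane (only continuity of the charts is required). -/
class OrientedSurface (S : Type*) [TopologicalSpace S] [ChartedSpace ℂ S] : Prop where
  compat : ∀ φ ∈ atlas ℂ S, ∀ ψ ∈ atlas ℂ S, ∀ x ∈ φ.source ∩ ψ.source,
    PreservesOrientationAt (fun z => ψ (φ.symm z)) (φ x)

/-- The homeomorphism `f` preserves the orientation given by the atlas of `S`. -/
def OrientationPreserving {S : Type*} [TopologicalSpace S] [ChartedSpace ℂ S] (f : S ≃ₜ S) :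
    Prop :=
  ∀ φ ∈ atlas ℂ S, ∀ ψ ∈ atlas ℂ S, ∀ x ∈ φ.source, f x ∈ ψ.source →
    PreservesOrientationAt (fun z => ψ (f (φ.symm z))) (φ x)

/-! ### Measured foliations with prong singularities -/

variable {S : Type*} [TopologicalSpace S]

/-- Near `x`, the real function `y` is a transverse coordinate for the family `A` of foliated
charts: it equals `± Im φ + c` for a chart `φ` of the family around `x`. The leaves are then
given near `x` by `y = const`, and the transverse measure by `|dy|`. -/
def IsTransverseCoord (A : Set (OpenPartialHomeomorph S ℂ)) (y : S → ℝ) (x : S) : Prop :=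
  ∃ φ ∈ A, x ∈ φ.source ∧ ∃ ε c : ℝ, (ε = 1 ∨ ε = -1) ∧
    ∀ᶠ x' in 𝓝 x, y x' = ε * (φ x').im + c

/-- Near `x`, the function `w` is a continuous branch of `χ ^ (k / 2)`. -/
def IsHalfPower (χ : OpenPartialHomeomorph S ℂ) (k : ℕ) (w : S → ℂ) (x : S) : Prop :=
  ∀ᶠ x' in 𝓝 x, ContinuousAt w x' ∧ w x' ^ 2 = χ x' ^ k

/-- A (topological) measured foliation with prong singularities, spines (`k = 1`) included.
Away from the singular set it is given by an atlas of charts whose transition maps have the form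
`(x, y) ↦ (h (x, y), ± y + c)` locally; the leaves are locally `y = const`, and the transverse
measure is `|dy|`. At a singularity there are, for some `k = 1, 3, 4, 5, ...`, a coordinate `z`
centred at it in which the leaves are locally `Im (z ^ (k / 2)) = const` and the
transverse measure is `|d Im (z ^ (k / 2))|` (a `k`-prong singularity). -/
structure MeasuredFoliation (S : Type*) [TopologicalSpace S] where
  charts : Set (OpenPartialHomeomorph S ℂ)
  sing : Set S
  cover : ∀ x, (∃ φ ∈ charts, x ∈ φ.source) ↔ x ∉ sing
  compat : ∀ φ ∈ charts, ∀ ψ ∈ charts, ∀ x ∈ φ.source ∩ ψ.source,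
    ∃ ε c : ℝ, (ε = 1 ∨ ε = -1) ∧ ∀ᶠ x' in 𝓝 x, (ψ x').im = ε * (φ x').im + c
  prong : ∀ p ∈ sing, ∃ k : ℕ, 1 ≤ k ∧ k ≠ 2 ∧ ∃ χ : OpenPartialHomeomorph S ℂ,
    p ∈ χ.source ∧ χ p = 0 ∧ ∀ x ∈ χ.source, x ≠ p →
      ∃ w : S → ℂ, IsHalfPower χ k w x ∧ IsTransverseCoord charts (fun x' => (w x').im) x

namespace MeasuredFoliation

/-- `y` is a transverse coordinate of the measured foliation near `x`. -/
def IsCoord (F : MeasuredFoliation S) (y : S → ℝ) (x : S) : Prop :=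
  IsTransverseCoord F.charts y x

/-- `F` and `G` are transverse. They have the same singularities; around a regular point there is
a chart `χ` in which the leaves of `F` are horizontal with transverse measure `|d Im χ|` and those
of `G` vertical with transverse measure `|d Re χ|`; and around a singularity there is a chart in
which `F` and `G` are, in the same way, given by the imaginary and the real part of
`χ ^ (k / 2)`. -/
def Transverse (F G : MeasuredFoliation S) : Prop :=
  F.sing = G.sing ∧
  (∀ p ∉ F.sing, ∃ χ : OpenPartialHomeomorph S ℂ, p ∈ χ.source ∧ ∀ x ∈ χ.source,
    F.IsCoord (fun x' => (χ x').im) x ∧ G.IsCoord (fun x' => (χ x').re) x) ∧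
  (∀ p ∈ F.sing, ∃ k : ℕ, 1 ≤ k ∧ k ≠ 2 ∧ ∃ χ : OpenPartialHomeomorph S ℂ,
    p ∈ χ.source ∧ χ p = 0 ∧ ∀ x ∈ χ.source, x ≠ p → ∃ w : S → ℂ, IsHalfPower χ k w x ∧
      F.IsCoord (fun x' => (w x').im) x ∧ G.IsCoord (fun x' => (w x').re) x)

/-- `F` is invariant under the homeomorphism `f`, which multiplies its transverse measure by `a`:
`μ (f α) = a * μ α` for every transverse arc `α`. In transverse coordinates: if `y` is one near
`f x`, then `a⁻¹ * (y ∘ f)` is one near `x`. -/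
def InvariantWithFactor (F : MeasuredFoliation S) (f : S ≃ₜ S) (a : ℝ) : Prop :=
  (∀ x, f x ∈ F.sing ↔ x ∈ F.sing) ∧
  ∀ x ∉ F.sing, ∀ y : S → ℝ, F.IsCoord y (f x) → F.IsCoord (fun x' => a⁻¹ * y (f x')) x

/-- The restriction of `γ` to `D` is a continuous curve in the complement of `P` that stays in one
leaf of `F` (used for `F.sing ⊆ P`): transverse coordinates are locally constant along it. -/
def IsLeafCurve (F : MeasuredFoliation S) (P : Set S) (D : Set ℝ) (γ : ℝ → S) : Prop :=
  ContinuousOn γ D ∧ ∀ t ∈ D, γ t ∉ P ∧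
    ∀ y : S → ℝ, F.IsCoord y (γ t) → ∀ᶠ s in 𝓝[D] t, y (γ s) = y (γ t)

/-- `γ` parametrizes, on `(0, ∞)`, a separatrix of the point `p`: a complete leaf of the
restriction of `F` to the complement of `P` that starts at `p = γ 0`. Completeness is the
last clause: a leaf curve that starts on the separatrix stays on it. For `x = γ t` with `0 < t`,
the leaf interval `(p, x]` is `γ '' Ioc 0 t`. -/
structure IsSeparatrix (F : MeasuredFoliation S) (P : Set S) (p : S) (γ : ℝ → S) : Prop where
  continuousOn : ContinuousOn γ (Ici 0)
  injOn : InjOn γ (Ici 0)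
  start : γ 0 = p
  leaf : F.IsLeafCurve P (Ioi 0) γ
  complete : ∀ c : ℝ → S, F.IsLeafCurve P (Icc 0 1) c → c 0 ∈ γ '' Ioi 0 →
    ∀ t ∈ Icc (0 : ℝ) 1, c t ∈ γ '' Ioi 0

end MeasuredFoliation

/-! ### Pseudo-Anosov homeomorphisms and first intersection points -/

/-- `f` is a generalized pseudo-Anosov homeomorphism with stable foliation `Fs`, unstable foliation
`Fu` and stretch factor `lam`. -/
structure IsPseudoAnosov [ChartedSpace ℂ S] (f : S ≃ₜ S) (Fs Fu : MeasuredFoliation S)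
    (lam : ℝ) : Prop where
  orientation : OrientationPreserving f
  one_lt : 1 < lam
  transverse : Fs.Transverse Fu
  stable : Fs.InvariantWithFactor f lam
  unstable : Fu.InvariantWithFactor f lam⁻¹

/-- `P` is an admissible set `Sing(f)`: the set of singularities of the foliations if there are any,
and otherwise a finite family of periodic points of `f`. -/
def IsSingSet (f : S ≃ₜ S) (F : MeasuredFoliation S) (P : Set S) : Prop :=
  (F.sing.Nonempty → P = F.sing) ∧
  (F.sing = ∅ → P.Finite ∧ ∀ p ∈ P, p ∈ Function.periodicPts f)

/-- `z` is a first intersection point: it lies outside `Sing(f) = P`, on a stable separatrix of some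
`p ∈ P` and on an unstable separatrix of some `q ∈ P`, and `(p, z]^s ∩ (q, z]^u = {z}`. -/
def IsFirstIntersectionPoint (Fs Fu : MeasuredFoliation S) (P : Set S) (z : S) : Prop :=
  z ∉ P ∧ ∃ p ∈ P, ∃ q ∈ P, ∃ γ δ : ℝ → S,
    Fs.IsSeparatrix P p γ ∧ Fu.IsSeparatrix P q δ ∧
    ∃ s > 0, ∃ t > 0, γ s = z ∧ δ t = z ∧ γ '' Ioc 0 s ∩ δ '' Ioc 0 t = {z}

/-- The full orbit of `z` under `f`. -/
def fullOrbit (f : S ≃ₜ S) (z : S) : Set S := range fun n : ℤ => (f ^ n) z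

end PA

end

open Set Filter Topology

noncomputable section

namespace PA

variable {S : Type*} [TopologicalSpace S]

namespace MeasuredFoliation

variable {F G : MeasuredFoliation S}

/-! ### Transverse coordinates -/

/-! There are only finitely many separatrices up to reparametrization. By compactness `P` is finite;
in a prong chart `χ` a separatrix begins on one of the `k` rays where `χ ^ k` is nonnegative, and
two separatrices beginning on the same ray agree (`IsProngChart.reparam`,
`Transverse.exists_finite_classes`). It therefore suffices to treat one stable separatrix `γ` and
one unstable separatrix `δ`.

By the pigeonhole principle some power `g` of `f` maps both to themselves, through increasing
changes of parameter `u` and `v` (`IsSeparatrix.exists_reparam_iterate`). The unstable measure is a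
length along `γ`, and `g` contracts it, so `u t < t` everywhere (`IsSeparatrix.param_lt`).

Suppose `γ a = δ b` is a first intersection. Iterates of `g` move every other one to a parameter of
`γ` in the fundamental domain `[u a, a]`. The curves also meet at `γ (u a) = δ (v b)`, so a first
intersection in that range cannot have a parameter on `δ` beyond `v b`. All of them thus lie on two
compact arcs of transverse leaves, which cross finitely often (`IsSeparatrix.finite_meetFirst`).
Finitely many `g`-orbits give finitely many `f`-orbits. -/

theorem IsCoord.notMem_sing {y : S → ℝ} {x : S} (h : F.IsCoord y x) : x ∉ F.sing := by
  obtain ⟨φ, hφ, hx, -⟩ := h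
  exact (F.cover x).1 ⟨φ, hφ, hx⟩

theorem exists_isCoord {x : S} (hx : x ∉ F.sing) : ∃ y, F.IsCoord y x := by
  obtain ⟨φ, hφ, hxφ⟩ := (F.cover x).2 hx
  exact ⟨fun x' => (φ x').im, φ, hφ, hxφ, 1, 0, Or.inl rfl, by simp⟩

theorem IsCoord.affine {y y' : S → ℝ} {x : S} {ε c : ℝ} (h : F.IsCoord y x)
    (hε : ε = 1 ∨ ε = -1) (hy : ∀ᶠ x' in 𝓝 x, y' x' = ε * y x' + c) : F.IsCoord y' x := by
  obtain ⟨φ, hφ, hx, ε', c', hε', he⟩ := h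
  refine ⟨φ, hφ, hx, ε * ε', ε * c' + c, ?_, ?_⟩
  · rcases hε with rfl | rfl <;> rcases hε' with rfl | rfl <;> norm_num
  · filter_upwards [he, hy] with x' h1 h2
    rw [h2, h1]; ring

theorem IsCoord.exists_affine {y y' : S → ℝ} {x : S} (h : F.IsCoord y x) (h' : F.IsCoord y' x) :
    ∃ ε c : ℝ, (ε = 1 ∨ ε = -1) ∧ ∀ᶠ x' in 𝓝 x, y' x' = ε * y x' + c := by
  obtain ⟨φ, hφ, hx, ε, c, hε, he⟩ := h
  obtain ⟨ψ, hψ, hx', ε', c', hε', he'⟩ := h'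
  obtain ⟨ε₀, c₀, hε₀, he₀⟩ := F.compat φ hφ ψ hψ x ⟨hx, hx'⟩
  have hsq : ε * ε = 1 := by rcases hε with rfl | rfl <;> norm_num
  refine ⟨ε' * ε₀ * ε, c' + ε' * c₀ - ε' * ε₀ * ε * c, ?_, ?_⟩
  · rcases hε with rfl | rfl <;> rcases hε' with rfl | rfl <;> rcases hε₀ with rfl | rfl <;>
      norm_num
  · filter_upwards [he, he', he₀] with x' h1 h2 h3
    rw [h2, h3, h1]
    linear_combination (-(ε' * ε₀ * (φ x').im)) * hsq

/-- Invariance only pulls coordinates back. To push one forward, pull back some coordinate at `x`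
and compare the two at `f⁻¹ x`, where they differ by a sign and a constant. -/
theorem InvariantWithFactor.inv {f : S ≃ₜ S} {a : ℝ} (ha : a ≠ 0)
    (h : F.InvariantWithFactor f a) : F.InvariantWithFactor f⁻¹ a⁻¹ := by
  have hs : ∀ x, f⁻¹ x ∈ F.sing ↔ x ∈ F.sing := fun x => by
    rw [← h.1 (f⁻¹ x)]; simp
  refine ⟨hs, fun x hx y hy => ?_⟩
  obtain ⟨y₀, hy₀⟩ := F.exists_isCoord hx
  have h1 : F.IsCoord (fun x' => a⁻¹ * y₀ (f x')) (f⁻¹ x) :=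
    h.2 _ (fun h' => hx ((hs x).1 h')) y₀ (by simpa using hy₀)
  obtain ⟨ε, c, hε, he⟩ := h1.exists_affine hy
  refine hy₀.affine (c := a * c) hε ?_
  have : Tendsto (f⁻¹ : S ≃ₜ S) (𝓝 x) (𝓝 (f⁻¹ x)) := (f⁻¹ : S ≃ₜ S).continuous.tendsto x
  filter_upwards [this.eventually he] with x' h'
  rw [h']
  simp only [Homeomorph.inv_apply, Homeomorph.apply_symm_apply, inv_inv]
  field_simp

theorem InvariantWithFactor.mul {f g : S ≃ₜ S} {a b : ℝ} (hf : F.InvariantWithFactor f a)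
    (hg : F.InvariantWithFactor g b) : F.InvariantWithFactor (f * g) (a * b) := by
  refine ⟨fun x => (hf.1 (g x)).trans (hg.1 x), fun x hx y hy => ?_⟩
  have h1 := hg.2 x hx _ (hf.2 (g x) (fun h' => hx ((hg.1 x).1 h')) y hy)
  refine h1.affine (c := 0) (Or.inl rfl) (Eventually.of_forall fun x' => ?_)
  simp only [Homeomorph.mul_apply, mul_inv]
  ring

theorem InvariantWithFactor.pow {f : S ≃ₜ S} {a : ℝ} (hf : F.InvariantWithFactor f a) (n : ℕ) :
    F.InvariantWithFactor (f ^ n) (a ^ n) := by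
  induction n with
  | zero =>
    refine ⟨fun x => by simp, fun x _ y hy => ?_⟩
    simpa using hy
  | succ n ih =>
    rw [pow_succ, pow_succ]
    exact ih.mul hf

/-! ### Charts adapted to a pair of transverse foliations -/

/-- `χ` is a chart centred at `p` in which `F` and `G` are given by the imaginary and the real part
of `χ ^ (k / 2)`. -/
structure IsProngChart (F G : MeasuredFoliation S) (p : S) (k : ℕ)
    (χ : OpenPartialHomeomorph S ℂ) : Prop where
  one_le : 1 ≤ k
  mem_source : p ∈ χ.source
  map_center : χ p = 0
  exists_root : ∀ x ∈ χ.source, x ≠ p → ∃ w : S → ℂ, IsHalfPower χ k w x ∧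
    F.IsCoord (fun x' => (w x').im) x ∧ G.IsCoord (fun x' => (w x').re) x

/-- A regular point is treated as a 2-prong, with `w = χ - χ p`, so that later arguments need not
separate regular from singular points of `P`. -/
theorem Transverse.exists_isProngChart (h : F.Transverse G) (p : S) :
    ∃ k χ, IsProngChart F G p k χ := by
  by_cases hp : p ∈ F.sing
  · obtain ⟨k, hk, -, χ, h1, h2, h3⟩ := h.2.2 p hp
    exact ⟨k, χ, hk, h1, h2, h3⟩
  · obtain ⟨χ, hpχ, hχ⟩ := h.2.1 p hp
    refine ⟨2, χ.transHomeomorph (Homeomorph.addRight (-χ p)), by norm_num, hpχ, by simp,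
      fun x hx _ => ⟨fun x' => χ x' - χ p, ?_, ?_, ?_⟩⟩
    · filter_upwards [χ.open_source.mem_nhds hx] with x' hx'
      exact ⟨(χ.continuousAt hx').sub continuousAt_const, by simp [sub_eq_add_neg]⟩
    · exact (hχ x hx).1.affine (ε := 1) (c := -(χ p).im) (Or.inl rfl)
        (Eventually.of_forall fun x' => by simp [sub_eq_add_neg])
    · exact (hχ x hx).2.affine (ε := 1) (c := -(χ p).re) (Or.inl rfl)
        (Eventually.of_forall fun x' => by simp [sub_eq_add_neg])

/-- The chart `ζ * conj χ`. -/
def conjMul (χ : OpenPartialHomeomorph S ℂ) (ζ : ℂ) (hζ : ζ ≠ 0) : OpenPartialHomeomorph S ℂ :=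
  χ.transHomeomorph (Complex.conjCLE.toHomeomorph.trans (Homeomorph.mulLeft₀ ζ hζ))

@[simp]
theorem conjMul_apply (χ : OpenPartialHomeomorph S ℂ) (ζ : ℂ) (hζ : ζ ≠ 0) (x : S) :
    conjMul χ ζ hζ x = ζ * (starRingEnd ℂ) (χ x) := rfl

/-- The map `w ↦ I * conj w` exchanges real and imaginary parts. At a prong it is induced by `χ ↦ ζ
* conj χ` with `ζ ^ k = -1`, since `I ^ 2 = -1`. -/
theorem Transverse.symm (h : F.Transverse G) : G.Transverse F := by
  refine ⟨h.1.symm, fun p hp => ?_, fun p hp => ?_⟩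
  · obtain ⟨χ, hpχ, hχ⟩ := h.2.1 p (h.1 ▸ hp)
    refine ⟨conjMul χ Complex.I Complex.I_ne_zero, hpχ, fun x hx => ?_⟩
    simpa using (hχ x hx).symm
  · obtain ⟨k, hk, hk2, χ, hpχ, hp0, hχ⟩ := h.2.2 p (h.1 ▸ hp)
    obtain ⟨ζ, hζ⟩ := IsAlgClosed.exists_pow_nat_eq (-1 : ℂ) (by omega : 0 < k)
    have hζ0 : ζ ≠ 0 := by
      rintro rfl
      rw [zero_pow (by omega)] at hζ
      norm_num at hζ
    refine ⟨k, hk, hk2, conjMul χ ζ hζ0, hpχ, by simp [hp0], fun x hx hxp => ?_⟩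
    obtain ⟨w, hw, h1, h2⟩ := hχ x hx hxp
    refine ⟨fun x' => Complex.I * (starRingEnd ℂ) (w x'), ?_, by simpa using h2, by simpa using h1⟩
    filter_upwards [hw] with x' hx'
    refine ⟨continuousAt_const.mul (Complex.continuous_conj.continuousAt.comp hx'.1), ?_⟩
    rw [conjMul_apply, mul_pow, mul_pow, hζ, Complex.I_sq, ← map_pow, hx'.2, map_pow]

/-- A prong chart contains no singularity except possibly its centre, and finitely many such charts
cover `S`. -/
theorem Transverse.finite_sing [CompactSpace S] (h : F.Transverse G) : F.sing.Finite := by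
  choose k χ hχ using h.exists_isProngChart
  obtain ⟨t, ht⟩ := isCompact_univ.elim_nhds_subcover (fun p => (χ p).source)
    (fun p _ => (χ p).open_source.mem_nhds (hχ p).mem_source)
  refine t.finite_toSet.subset fun x hx => ?_
  obtain ⟨p, hp, hxp⟩ := mem_iUnion₂.1 (ht.2 (mem_univ x))
  by_cases hpx : x = p
  · rwa [hpx]
  · obtain ⟨w, -, hw, -⟩ := (hχ p).exists_root x hxp hpx
    exact absurd hx hw.notMem_sing

end MeasuredFoliation

/-! ### Parametrizations of separatrices -/

theorem eq_of_eventually_eq_Ioo {q : ℝ → ℝ} {a b : ℝ}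
    (h : ∀ t ∈ Ioo a b, ∀ᶠ s in 𝓝 t, q s = q t) {s t : ℝ} (hs : s ∈ Ioo a b) (ht : t ∈ Ioo a b) :
    q s = q t := by
  have hd : ∀ t ∈ Ioo a b, HasDerivAt q 0 t := fun t ht =>
    (hasDerivAt_const t (q t)).congr_of_eventuallyEq (h t ht)
  exact isOpen_Ioo.is_const_of_deriv_eq_zero isPreconnected_Ioo
    (fun t ht => (hd t ht).differentiableAt.differentiableWithinAt)
    (fun t ht => (hd t ht).deriv) hs ht

namespace MeasuredFoliation

variable {F G : MeasuredFoliation S} {P : Set S} {p : S} {γ : ℝ → S}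

theorem IsSeparatrix.continuousAt (hγ : F.IsSeparatrix P p γ) {s : ℝ} (hs : 0 < s) :
    ContinuousAt γ s :=
  hγ.continuousOn.continuousAt (Ici_mem_nhds hs)

theorem IsSeparatrix.injOn_Ioi (hγ : F.IsSeparatrix P p γ) : InjOn γ (Ioi 0) :=
  hγ.injOn.mono Ioi_subset_Ici_self

theorem IsSeparatrix.notMem (hγ : F.IsSeparatrix P p γ) {s : ℝ} (hs : 0 < s) : γ s ∉ P :=
  (hγ.leaf.2 s hs).1

theorem IsSeparatrix.eventually_coord_eq (hγ : F.IsSeparatrix P p γ) {s : ℝ} (hs : 0 < s)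
    {y : S → ℝ} (hy : F.IsCoord y (γ s)) : ∀ᶠ r in 𝓝 s, y (γ r) = y (γ s) := by
  have := (hγ.leaf.2 s hs).2 y hy
  rwa [isOpen_Ioi.nhdsWithin_eq (show s ∈ Ioi (0 : ℝ) from hs)] at this

/-- In a chart whose imaginary part is constant on the leaves, the real part is monotone along a
small piece of a separatrix. -/
theorem IsSeparatrix.exists_re_monotone (hγ : F.IsSeparatrix P p γ) {χ : OpenPartialHomeomorph S ℂ}
    {s δ : ℝ} (hs : 0 < s) (hδ : 0 < δ) (hx : γ s ∈ χ.source)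
    (hy : F.IsCoord (fun x => (χ x).im) (γ s)) :
    ∃ η > 0, η ≤ δ ∧ η < s ∧
      (∀ r ∈ Icc (s - η) (s + η), γ r ∈ χ.source ∧ (χ (γ r)).im = (χ (γ s)).im) ∧
      ContinuousOn (fun r => (χ (γ r)).re) (Icc (s - η) (s + η)) ∧
      (StrictMonoOn (fun r => (χ (γ r)).re) (Icc (s - η) (s + η)) ∨
        StrictAntiOn (fun r => (χ (γ r)).re) (Icc (s - η) (s + η))) := by
  have h1 : ∀ᶠ r in 𝓝 s, γ r ∈ χ.source ∧ (χ (γ r)).im = (χ (γ s)).im :=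
    ((hγ.continuousAt hs).eventually (χ.open_source.mem_nhds hx)).and
      (hγ.eventually_coord_eq hs hy)
  obtain ⟨e, he, h2⟩ := Metric.eventually_nhds_iff.1 h1
  refine ⟨min (e / 2) (min δ (s / 2)), by positivity,
    (min_le_right _ _).trans (min_le_left _ _),
    ((min_le_right _ _).trans (min_le_right _ _)).trans_lt (by linarith), ?_⟩
  set η := min (e / 2) (min δ (s / 2)) with hη
  have hη0 : 0 < η := by positivity
  have hηe : η ≤ e / 2 := min_le_left _ _
  have hηs : η ≤ s / 2 := (min_le_right _ _).trans (min_le_right _ _)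
  have h3 : ∀ r ∈ Icc (s - η) (s + η), γ r ∈ χ.source ∧ (χ (γ r)).im = (χ (γ s)).im := by
    intro r hr
    refine h2 ?_
    rw [Real.dist_eq, abs_lt]
    constructor <;> linarith [hr.1, hr.2]
  have hpos : ∀ r ∈ Icc (s - η) (s + η), 0 < r := fun r hr => by linarith [hr.1]
  have h4 : ContinuousOn (fun r => (χ (γ r)).re) (Icc (s - η) (s + η)) := fun r hr =>
    (Complex.continuous_re.continuousAt.comp
      ((χ.continuousAt (h3 r hr).1).comp (hγ.continuousAt (hpos r hr)))).continuousWithinAt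
  refine ⟨h3, h4, h4.strictMonoOn_of_injOn_Icc' (by linarith) fun r hr r' hr' h => ?_⟩
  refine hγ.injOn_Ioi (hpos r hr) (hpos r' hr') (χ.injOn (h3 r hr).1 (h3 r' hr').1 ?_)
  exact Complex.ext h ((h3 r hr).2.trans (h3 r' hr').2.symm)

/-- A leaf curve that meets a separatrix at `γ s` stays for a while on any piece of the separatrix
around `γ s`. -/
theorem IsSeparatrix.eventually_mem_image (hFG : F.Transverse G) (hP : F.sing ⊆ P)
    (hγ : F.IsSeparatrix P p γ) {s δ : ℝ} (hs : 0 < s) (hδ : 0 < δ) {D : Set ℝ} {c : ℝ → S}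
    (hc : F.IsLeafCurve P D c) {t : ℝ} (ht : t ∈ D) (hct : c t = γ s) :
    ∀ᶠ r in 𝓝[D] t, ∃ s', 0 < s' ∧ |s' - s| < δ ∧ γ s' = c r := by
  obtain ⟨χ, hx, hχ⟩ := hFG.2.1 (γ s) (fun h => hγ.notMem hs (hP h))
  obtain ⟨η, hη, hηδ, hηs, h1, h2, h3⟩ := hγ.exists_re_monotone hs (half_pos hδ) hx (hχ _ hx).1
  have hm : s ∈ Icc (s - η) (s + η) := ⟨by linarith, by linarith⟩
  have hl : s - η ∈ Icc (s - η) (s + η) := ⟨by linarith, by linarith⟩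
  have hr : s + η ∈ Icc (s - η) (s + η) := ⟨by linarith, by linarith⟩
  -- By the intermediate value theorem the arc fills a neighbourhood of `γ s` within its horizontal
  -- line; a nearby point at the same height must lie on it.
  have him : (fun r => (χ (γ r)).re) '' Icc (s - η) (s + η) ∈ 𝓝 (χ (γ s)).re := by
    rcases h3 with h3 | h3
    · exact mem_of_superset (Icc_mem_nhds (h3 hl hm (by linarith)) (h3 hm hr (by linarith)))
        (intermediate_value_Icc (by linarith) h2)
    · exact mem_of_superset (Icc_mem_nhds (h3 hm hr (by linarith)) (h3 hl hm (by linarith)))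
        (intermediate_value_Icc' (by linarith) h2)
  have hcc : Tendsto c (𝓝[D] t) (𝓝 (γ s)) := hct ▸ (hc.1 t ht)
  have hre : Tendsto (fun r => (χ (c r)).re) (𝓝[D] t) (𝓝 (χ (γ s)).re) :=
    (Complex.continuous_re.tendsto _).comp ((χ.continuousAt hx).tendsto.comp hcc)
  have hcoord := (hc.2 t ht).2 (fun x => (χ x).im) (by rw [hct]; exact (hχ _ hx).1)
  filter_upwards [hre him, hcc (χ.open_source.mem_nhds hx), hcoord] with r ⟨s', hs', e1⟩ hcr e2
  refine ⟨s', by linarith [hs'.1], ?_, χ.injOn (h1 s' hs').1 hcr (Complex.ext e1 ?_)⟩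
  · rw [abs_lt]; constructor <;> linarith [hs'.1, hs'.2]
  · rw [(h1 s' hs').2, e2, hct]

theorem IsLeafCurve.comp {D E : Set ℝ} {c : ℝ → S} (hc : F.IsLeafCurve P D c) {u : ℝ → ℝ}
    (hu : ContinuousOn u E) (h : MapsTo u E D) : F.IsLeafCurve P E (c ∘ u) := by
  refine ⟨hc.1.comp hu h, fun t ht => ⟨(hc.2 _ (h ht)).1, fun y hy => ?_⟩⟩
  exact ((hu t ht).tendsto_nhdsWithin h).eventually ((hc.2 _ (h ht)).2 y hy)

/-- A separatrix that meets another one is contained in it. -/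
theorem IsSeparatrix.image_subset {q : S} {δ : ℝ → S} (hγ : F.IsSeparatrix P p γ)
    (hδ : F.IsSeparatrix P q δ) {t₀ : ℝ} (ht₀ : 0 < t₀) (h : δ t₀ ∈ γ '' Ioi 0) {t : ℝ}
    (ht : 0 < t) : δ t ∈ γ '' Ioi 0 := by
  have hu : Continuous fun r : ℝ => t₀ + r * (t - t₀) := by fun_prop
  have hmaps : MapsTo (fun r : ℝ => t₀ + r * (t - t₀)) (Icc 0 1) (Ioi 0) := by
    intro r hr
    have h1 : 0 ≤ r * t := mul_nonneg hr.1 ht.le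
    have h2 : 0 ≤ (1 - r) * t₀ := mul_nonneg (by linarith [hr.2]) ht₀.le
    have h3 : 0 < t₀ + r * (t - t₀) := by
      rcases hr.1.eq_or_lt with h0 | h0
      · rw [← h0]; linarith
      · nlinarith [mul_pos h0 ht]
    exact h3
  have := hγ.complete _ (hδ.leaf.comp hu.continuousOn hmaps) (by simpa using h) 1 (by simp)
  simpa using this

end MeasuredFoliation

/-! ### Reparametrizations -/

/-- `γ₂` is, on `(0, ∞)`, an increasing reparametrization of `γ₁`. -/
def Reparam {X : Type*} (γ₁ γ₂ : ℝ → X) : Prop :=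
  ∃ u : Ioi (0 : ℝ) ≃o Ioi (0 : ℝ), ∀ t : Ioi (0 : ℝ), γ₂ t = γ₁ (u t)

theorem Reparam.trans {X : Type*} {γ₁ γ₂ γ₃ : ℝ → X} (h : Reparam γ₁ γ₂) (h' : Reparam γ₂ γ₃) :
    Reparam γ₁ γ₃ := by
  obtain ⟨u, hu⟩ := h
  obtain ⟨v, hv⟩ := h'
  exact ⟨v.trans u, fun t => by simp [hu, hv]⟩

theorem Reparam.comp {X : Type*} {γ₁ γ₂ : ℝ → X} (h : Reparam γ₁ γ₂) (f : X → X) :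
    Reparam (f ∘ γ₁) (f ∘ γ₂) := by
  obtain ⟨u, hu⟩ := h
  exact ⟨u, fun t => by simp [hu]⟩

theorem Reparam.iterate {X : Type*} {γ : ℝ → X} {f : X → X} (h : Reparam γ (f ∘ γ)) (n : ℕ) :
    Reparam γ (f^[n] ∘ γ) := by
  induction n with
  | zero => exact ⟨OrderIso.refl _, fun t => rfl⟩
  | succ n ih =>
    have := h.trans (ih.comp f)
    rwa [← Function.comp_assoc, ← Function.iterate_succ'] at this

/-! ### Rays at the starting point -/

/-- Near its starting point, `γ` runs on the ray of direction `ζ` in the chart `χ`. -/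
def StartsOnRay (χ : OpenPartialHomeomorph S ℂ) (γ : ℝ → S) (ζ : ℂ) : Prop :=
  ∃ ε > 0, ∀ t ∈ Ioo 0 ε, γ t ∈ χ.source ∧ χ (γ t) = ‖χ (γ t)‖ * ζ

namespace MeasuredFoliation

variable {F G : MeasuredFoliation S} {P : Set S} {p : S} {γ : ℝ → S}
  {k : ℕ} {χ : OpenPartialHomeomorph S ℂ}

theorem IsSeparatrix.ne_start (hγ : F.IsSeparatrix P p γ) {t : ℝ} (ht : 0 < t) : γ t ≠ p :=
  fun h => ht.ne' (hγ.injOn (mem_Ici.2 ht.le) (mem_Ici.2 le_rfl) (h.trans hγ.start.symm))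

theorem IsProngChart.exists_mem_source (hχ : IsProngChart F G p k χ)
    (hγ : F.IsSeparatrix P p γ) : ∃ ε > 0, ∀ t ∈ Ico 0 ε, γ t ∈ χ.source := by
  have h1 : ∀ᶠ t in 𝓝[≥] (0 : ℝ), γ t ∈ χ.source := by
    refine (hγ.continuousOn 0 (mem_Ici.2 le_rfl)).eventually (χ.open_source.mem_nhds ?_)
    rw [hγ.start]; exact hχ.mem_source
  obtain ⟨ε, hε, h2⟩ := mem_nhdsGE_iff_exists_Ico_subset.1 h1
  exact ⟨ε, hε, fun t ht => h2 ht⟩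

theorem IsSeparatrix.continuousOn_chart (hγ : F.IsSeparatrix P p γ) {ε : ℝ}
    (hε : ∀ t ∈ Ico 0 ε, γ t ∈ χ.source) :
    ContinuousOn (fun t => χ (γ t)) (Ico 0 ε) :=
  χ.continuousOn.comp (hγ.continuousOn.mono Ico_subset_Ici_self) hε

theorem IsProngChart.ne_zero (hχ : IsProngChart F G p k χ)
    (hγ : F.IsSeparatrix P p γ) {t : ℝ} (ht : 0 < t) (h : γ t ∈ χ.source) : χ (γ t) ≠ 0 :=
  fun h0 => hγ.ne_start ht (χ.injOn h hχ.mem_source (h0.trans hχ.map_center.symm))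

/-- A separatrix lies, near its starting point, where `χ ^ k` is a nonnegative real number. -/
theorem IsProngChart.pow_eq_norm (hχ : IsProngChart F G p k χ) (hγ : F.IsSeparatrix P p γ)
    {ε : ℝ} (hε : ∀ t ∈ Ico 0 ε, γ t ∈ χ.source) {t : ℝ} (ht : t ∈ Ioo 0 ε) :
    χ (γ t) ^ k = (‖χ (γ t) ^ k‖ : ℂ) := by
  -- With `χ ^ k = w ^ 2` this is `2 * (Im w) ^ 2`, hence locally constant along the leaf although
  -- `w` is only a local branch. It vanishes at the starting point.
  set q : ℝ → ℝ := fun t => ‖χ (γ t) ^ k‖ - (χ (γ t) ^ k).re with hq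
  have hq0 : q 0 = 0 := by
    simp [hq, hγ.start, hχ.map_center, zero_pow (show k ≠ 0 by have := hχ.one_le; omega)]
  have hcont : ContinuousOn q (Ico 0 ε) := by
    have := (hγ.continuousOn_chart hε).pow k
    exact this.norm.sub (Complex.continuous_re.comp_continuousOn this)
  have hloc : ∀ t ∈ Ioo 0 ε, ∀ᶠ s in 𝓝 t, q s = q t := by
    intro t ht
    obtain ⟨w, hw, h1, -⟩ := hχ.exists_root (γ t) (hε t ⟨ht.1.le, ht.2⟩) (hγ.ne_start ht.1)
    have key : ∀ z : ℂ, ‖z ^ 2‖ - (z ^ 2).re = 2 * z.im ^ 2 := fun z => by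
      rw [norm_pow, ← Complex.normSq_eq_norm_sq, Complex.normSq_apply, sq z, Complex.mul_re]; ring
    have h2 := (hγ.continuousAt ht.1).eventually hw
    filter_upwards [h2, hγ.eventually_coord_eq ht.1 h1] with s h3 h4
    simp only [hq]
    rw [← h3.2, ← h2.self_of_nhds.2, key, key, h4]
  have hzero : q t = 0 := by
    have h1 : Tendsto q (𝓝[>] 0) (𝓝 (q 0)) :=
      ((hcont 0 ⟨le_rfl, ht.1.trans ht.2⟩).mono_of_mem_nhdsWithin
        (Ico_mem_nhdsGE (ht.1.trans ht.2))).tendsto.mono_left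
          (nhdsWithin_mono _ Ioi_subset_Ici_self)
    have h2 : Tendsto q (𝓝[>] 0) (𝓝 (q t)) := by
      refine tendsto_const_nhds.congr' ?_
      filter_upwards [Ioo_mem_nhdsGT (ht.1.trans ht.2)] with s hs
      exact eq_of_eventually_eq_Ioo hloc ht hs
    rw [tendsto_nhds_unique h2 h1, hq0]
  have h3 : (χ (γ t) ^ k).re = ‖χ (γ t) ^ k‖ := by simp only [hq] at hzero; linarith
  have h4 : (χ (γ t) ^ k).im = 0 := by
    have := Complex.normSq_apply (χ (γ t) ^ k)
    rw [Complex.normSq_eq_norm_sq, ← h3] at this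
    nlinarith
  exact Complex.ext (by rw [Complex.ofReal_re, h3]) (by simp only [h4, Complex.ofReal_im])

/-- The direction `χ / ‖χ‖` is continuous along the curve and takes values in the finite set of
`k`-th roots of unity, so it is constant. -/
theorem IsProngChart.exists_startsOnRay (hχ : IsProngChart F G p k χ)
    (hγ : F.IsSeparatrix P p γ) : ∃ ζ : ℂ, ζ ^ k = 1 ∧ StartsOnRay χ γ ζ := by
  obtain ⟨ε, hε0, hε⟩ := hχ.exists_mem_source hγ
  have hk : 0 < k := hχ.one_le
  have hne : ∀ t ∈ Ioo 0 ε, (‖χ (γ t)‖ : ℂ) ≠ 0 := fun t ht => by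
    simpa using hχ.ne_zero hγ ht.1 (hε t ⟨ht.1.le, ht.2⟩)
  set d : ℝ → ℂ := fun t => χ (γ t) / ‖χ (γ t)‖ with hd
  have hdk : ∀ t ∈ Ioo 0 ε, d t ^ k = 1 := fun t ht => by
    have h0 := pow_ne_zero k (hne t ht)
    simp only [hd]
    rw [div_pow, div_eq_one_iff_eq h0, hχ.pow_eq_norm hγ hε ht, norm_pow]
    push_cast; rfl
  have hdc : ContinuousOn d (Ioo 0 ε) := by
    have h1 := (hγ.continuousOn_chart hε).mono Ioo_subset_Ico_self
    exact h1.div (Complex.continuous_ofReal.comp_continuousOn h1.norm) hne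
  have hfin : {z : ℂ | z ^ k = 1}.Finite := by
    refine ((Polynomial.nthRoots k (1 : ℂ)).toFinset.finite_toSet).subset fun z hz => ?_
    simpa [Polynomial.mem_nthRoots hk] using hz
  have hm : ε / 2 ∈ Ioo 0 ε := ⟨by linarith, by linarith⟩
  refine ⟨d (ε / 2), hdk _ hm, ε, hε0, fun t ht => ⟨hε t ⟨ht.1.le, ht.2⟩, ?_⟩⟩
  rw [← isPreconnected_Ioo.constant_of_mapsTo hfin.isDiscrete hdc hdk ht hm]
  simp only [hd]
  rw [mul_div_cancel₀ _ (hne t ht)]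

/-- Of two separatrices that start on the same ray, each one covers the beginning of the other. -/
theorem IsProngChart.exists_small_param {γ₁ γ₂ : ℝ → S} (hχ : IsProngChart F G p k χ)
    (h₁ : F.IsSeparatrix P p γ₁) (h₂ : F.IsSeparatrix P p γ₂) {ζ : ℂ}
    (r₁ : StartsOnRay χ γ₁ ζ) (r₂ : StartsOnRay χ γ₂ ζ) {e : ℝ} (he : 0 < e) :
    ∃ η > 0, ∀ t ∈ Ioo 0 η, ∃ s ∈ Ioo 0 e, γ₁ s = γ₂ t := by
  obtain ⟨ε₁, hε₁, H₁⟩ := r₁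
  obtain ⟨ε₂, hε₂, H₂⟩ := r₂
  obtain ⟨ε₀, hε₀, K₁⟩ := hχ.exists_mem_source h₁
  obtain ⟨ε₀', hε₀', K₂⟩ := hχ.exists_mem_source h₂
  set b := min (e / 2) (min (ε₁ / 2) (ε₀ / 2)) with hb
  have hb0 : 0 < b := by positivity
  have hbe : b ≤ e / 2 := min_le_left _ _
  have hb1 : b ≤ ε₁ / 2 := (min_le_right _ _).trans (min_le_left _ _)
  have hb2 : b ≤ ε₀ / 2 := (min_le_right _ _).trans (min_le_right _ _)
  have hc₁ : ContinuousOn (fun t => ‖χ (γ₁ t)‖) (Icc 0 b) :=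
    (h₁.continuousOn_chart K₁).norm.mono fun t ht => ⟨ht.1, by linarith [ht.2]⟩
  have hpos : 0 < ‖χ (γ₁ b)‖ := norm_pos_iff.2 (hχ.ne_zero h₁ hb0 (K₁ b ⟨hb0.le, by linarith⟩))
  have hc₂ : Tendsto (fun t => ‖χ (γ₂ t)‖) (𝓝[>] 0) (𝓝 0) := by
    have := (((h₂.continuousOn_chart K₂).norm 0 ⟨le_rfl, hε₀'⟩).mono_of_mem_nhdsWithin
        (Ico_mem_nhdsGE hε₀')).tendsto.mono_left (nhdsWithin_mono _ Ioi_subset_Ici_self)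
    simpa [h₂.start, hχ.map_center] using this
  have hev : ∀ᶠ t in 𝓝[>] (0 : ℝ), ‖χ (γ₂ t)‖ < ‖χ (γ₁ b)‖ ∧ t ∈ Ioo 0 ε₂ :=
    (hc₂.eventually (gt_mem_nhds hpos)).and (Ioo_mem_nhdsGT hε₂)
  obtain ⟨η, hη, hsub⟩ := mem_nhdsGT_iff_exists_Ioo_subset.1 hev
  refine ⟨η, hη, fun t ht => ?_⟩
  obtain ⟨hlt, ht2⟩ := hsub ht
  obtain ⟨hsrc, hray⟩ := H₂ t ht2
  have hpos2 : 0 < ‖χ (γ₂ t)‖ := norm_pos_iff.2 (hχ.ne_zero h₂ ht.1 hsrc)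
  have h0 : ‖χ (γ₁ 0)‖ = 0 := by simp [h₁.start, hχ.map_center]
  obtain ⟨s, hs, hse⟩ := intermediate_value_Icc hb0.le hc₁
    (show ‖χ (γ₂ t)‖ ∈ Icc ‖χ (γ₁ 0)‖ ‖χ (γ₁ b)‖ from ⟨by rw [h0]; exact hpos2.le, hlt.le⟩)
  simp only at hse
  have hs0 : 0 < s := by
    rcases hs.1.eq_or_lt with h | h
    · rw [← h, h0] at hse; linarith
    · exact h
  obtain ⟨hsrc1, hray1⟩ := H₁ s ⟨hs0, by linarith [hs.2]⟩
  exact ⟨s, ⟨hs0, by linarith [hs.2]⟩, χ.injOn hsrc1 hsrc (by rw [hray1, hray, hse])⟩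

/-- Near `p` the curves overlap, so by completeness each covers the other and the change of
parameter is a bijection. It is continuous because leaves are locally arcs, and increasing because
beginnings correspond to beginnings. -/
theorem IsProngChart.reparam (hFG : F.Transverse G) (hP : F.sing ⊆ P) {γ₁ γ₂ : ℝ → S}
    (hχ : IsProngChart F G p k χ)
    (h₁ : F.IsSeparatrix P p γ₁) (h₂ : F.IsSeparatrix P p γ₂) {ζ : ℂ}
    (r₁ : StartsOnRay χ γ₁ ζ) (r₂ : StartsOnRay χ γ₂ ζ) : Reparam γ₁ γ₂ := by
  have hcover : ∀ {δ₁ δ₂ : ℝ → S}, F.IsSeparatrix P p δ₁ → F.IsSeparatrix P p δ₂ →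
      StartsOnRay χ δ₁ ζ → StartsOnRay χ δ₂ ζ → ∀ t : ℝ, 0 < t → δ₂ t ∈ δ₁ '' Ioi 0 := by
    intro δ₁ δ₂ g₁ g₂ s₁ s₂ t ht
    obtain ⟨η, hη, h⟩ := hχ.exists_small_param g₁ g₂ s₁ s₂ one_pos
    obtain ⟨s, hs, hse⟩ := h (η / 2) ⟨by linarith, by linarith⟩
    exact g₁.image_subset g₂ (half_pos hη) ⟨s, hs.1, hse⟩ ht
  choose! u hu0 hu using hcover h₁ h₂ r₁ r₂
  choose! v hv0 hv using hcover h₂ h₁ r₂ r₁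
  have huc : ContinuousOn u (Ioi 0) := by
    intro t ht
    refine Metric.tendsto_nhds.2 fun δ hδ => ?_
    have := h₁.eventually_mem_image hFG hP (hu0 t ht) hδ h₂.leaf ht (hu t ht).symm
    filter_upwards [this, self_mem_nhdsWithin] with r ⟨s', hs', hlt, he⟩ hr
    have : u r = s' := h₁.injOn_Ioi (hu0 r hr) hs' ((hu r hr).trans he.symm)
    rwa [this, Real.dist_eq]
  have hui : InjOn u (Ioi 0) := fun s hs t ht h => h₂.injOn_Ioi hs ht (by rw [← hu s hs, h, hu t ht])
  have huv : ∀ t : ℝ, 0 < t → u (v t) = t := fun t ht =>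
    h₁.injOn_Ioi (hu0 _ (hv0 t ht)) ht ((hu _ (hv0 t ht)).trans (hv t ht))
  have hvu : ∀ t : ℝ, 0 < t → v (u t) = t := fun t ht =>
    h₂.injOn_Ioi (hv0 _ (hu0 t ht)) ht ((hv _ (hu0 t ht)).trans (hu t ht))
  have hmono : StrictMonoOn u (Ioi 0) := by
    intro s hs t ht hst
    -- This provides some `r < s` with `u r < u s`, which rules out that `u` is decreasing on `[r,
    -- t]`.
    obtain ⟨η, hη, h⟩ := hχ.exists_small_param h₁ h₂ r₁ r₂ (hu0 s hs)
    set r := min (η / 2) (s / 2) with hr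
    have hs' : 0 < s := hs
    have hr0 : 0 < r := by positivity
    have hrs : r < s := (min_le_right _ _).trans_lt (by linarith)
    obtain ⟨s', hs', he⟩ := h r ⟨hr0, (min_le_left _ _).trans_lt (by linarith)⟩
    have hlt : u r < u s := by
      have : u r = s' := h₁.injOn_Ioi (hu0 r hr0) hs'.1 ((hu r hr0).trans he.symm)
      rw [this]; exact hs'.2
    have hsub : Icc r t ⊆ Ioi 0 := fun x hx => hr0.trans_le hx.1
    rcases (huc.mono hsub).strictMonoOn_of_injOn_Icc' (by linarith) (hui.mono hsub) with hm | hm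
    · exact hm ⟨hrs.le, hst.le⟩ ⟨by linarith, le_rfl⟩ hst
    · exact absurd (hm ⟨le_rfl, by linarith⟩ ⟨hrs.le, hst.le⟩ hrs) hlt.not_gt
  let e : Ioi (0 : ℝ) ≃ Ioi (0 : ℝ) :=
    { toFun := fun t => ⟨u t, hu0 t t.2⟩
      invFun := fun t => ⟨v t, hv0 t t.2⟩
      left_inv := fun t => Subtype.ext (hvu t t.2)
      right_inv := fun t => Subtype.ext (huv t t.2) }
  refine ⟨⟨e, ?_⟩, fun t => (hu t t.2).symm⟩
  intro s t
  exact hmono.le_iff_le s.2 t.2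

/-- Up to reparametrization there are only finitely many separatrices. -/
theorem Transverse.exists_finite_classes (hFG : F.Transverse G) (hP : F.sing ⊆ P)
    (hfin : P.Finite) : ∃ (I : Set (S × ℂ)) (i : (ℝ → S) → S × ℂ), I.Finite ∧
      (∀ p ∈ P, ∀ γ, F.IsSeparatrix P p γ → i γ ∈ I) ∧
      ∀ p ∈ P, ∀ q ∈ P, ∀ γ δ, F.IsSeparatrix P p γ → F.IsSeparatrix P q δ → i γ = i δ →
        Reparam γ δ := by
  choose k χ hχ using hFG.exists_isProngChart
  -- The implication lets a direction be chosen for every curve; for a curve that is no separatrix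
  -- the value `0` is a dummy.
  have hex : ∀ γ : ℝ → S, ∃ ζ : ℂ, F.IsSeparatrix P (γ 0) γ →
      ζ ^ k (γ 0) = 1 ∧ StartsOnRay (χ (γ 0)) γ ζ := fun γ => by
    by_cases h : F.IsSeparatrix P (γ 0) γ
    · obtain ⟨ζ, hζ⟩ := (hχ (γ 0)).exists_startsOnRay h
      exact ⟨ζ, fun _ => hζ⟩
    · exact ⟨0, fun h' => absurd h' h⟩
  choose ζ hζ using hex
  refine ⟨⋃ p ∈ P, {p} ×ˢ {z : ℂ | z ^ k p = 1}, fun γ => (γ 0, ζ γ), ?_, ?_, ?_⟩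
  · refine hfin.biUnion fun p _ => (finite_singleton p).prod ?_
    refine ((Polynomial.nthRoots (k p) (1 : ℂ)).toFinset.finite_toSet).subset fun z hz => ?_
    simpa [Polynomial.mem_nthRoots (show 0 < k p from (hχ p).one_le)] using hz
  · intro p hp γ hγ
    obtain rfl := hγ.start
    exact mem_biUnion hp ⟨rfl, (hζ γ hγ).1⟩
  · intro p hp q hq γ δ hγ hδ h
    obtain rfl := hγ.start
    obtain rfl := hδ.start
    obtain ⟨h0, h1⟩ := Prod.ext_iff.1 h
    simp only at h0 h1
    have hr := (hζ δ hδ).2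
    rw [← h0, ← h1] at hr
    rw [← h0] at hδ
    exact (hχ (γ 0)).reparam hFG hP hγ hδ (hζ γ hγ).2 hr

end MeasuredFoliation

/-! ### The action of a homeomorphism on the separatrices -/

namespace MeasuredFoliation

variable {F G : MeasuredFoliation S} {P : Set S} {p : S} {γ : ℝ → S}
  {k : ℕ} {χ : OpenPartialHomeomorph S ℂ} {f : S ≃ₜ S} {a : ℝ}

theorem IsLeafCurve.image (hf : F.InvariantWithFactor f a) (ha : a ≠ 0) (hP : F.sing ⊆ P)
    (hfP : ∀ x, f x ∈ P ↔ x ∈ P) {D : Set ℝ} {c : ℝ → S} (hc : F.IsLeafCurve P D c) :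
    F.IsLeafCurve P D (f ∘ c) := by
  refine ⟨f.continuous.comp_continuousOn hc.1, fun t ht => ⟨?_, fun y hy => ?_⟩⟩
  · rw [Function.comp_apply, hfP]; exact (hc.2 t ht).1
  · have h1 := hf.2 (c t) (fun h => (hc.2 t ht).1 (hP h)) y hy
    filter_upwards [(hc.2 t ht).2 _ h1] with s hs
    exact mul_left_cancel₀ (inv_ne_zero ha) hs

theorem IsSeparatrix.image (hf : F.InvariantWithFactor f a) (ha : a ≠ 0) (hP : F.sing ⊆ P)
    (hfP : ∀ x, f x ∈ P ↔ x ∈ P) (hγ : F.IsSeparatrix P p γ) :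
    F.IsSeparatrix P (f p) (f ∘ γ) where
  continuousOn := f.continuous.comp_continuousOn hγ.continuousOn
  injOn := f.injective.comp_injOn hγ.injOn
  start := by simp [hγ.start]
  leaf := hγ.leaf.image hf ha hP hfP
  complete := by
    intro c hc h0 t ht
    have hfP' : ∀ x, f⁻¹ x ∈ P ↔ x ∈ P := fun x => by rw [← hfP (f⁻¹ x)]; simp
    have h1 := hc.image (hf.inv ha) (inv_ne_zero ha) hP hfP'
    obtain ⟨s, hs, he⟩ := h0
    obtain ⟨r, hr, he'⟩ := hγ.complete _ h1 ⟨s, hs, by simp [← he]⟩ t ht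
    exact ⟨r, hr, by simp [he']⟩

/-- The images of `γ` fall into finitely many classes, so two iterates `m < n` agree up to
reparametrization; cancelling `f^[m]` leaves the iterate `n - m`. -/
theorem IsSeparatrix.exists_reparam_iterate (hFG : F.Transverse G) (hP : F.sing ⊆ P)
    (hfin : P.Finite) (hf : F.InvariantWithFactor f a) (ha : a ≠ 0) (hfP : ∀ x, f x ∈ P ↔ x ∈ P)
    (hp : p ∈ P) (hγ : F.IsSeparatrix P p γ) : ∃ n : ℕ, 0 < n ∧ Reparam γ (f^[n] ∘ γ) := by
  obtain ⟨I, i, hI, hi, hr⟩ := hFG.exists_finite_classes hP hfin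
  have h1 : ∀ n : ℕ, f^[n] p ∈ P ∧ F.IsSeparatrix P (f^[n] p) (f^[n] ∘ γ) := by
    intro n
    induction n with
    | zero => exact ⟨hp, hγ⟩
    | succ n ih =>
      rw [Function.iterate_succ', Function.comp_assoc]
      exact ⟨(hfP _).2 ih.1, ih.2.image hf ha hP hfP⟩
  have := hI.to_subtype
  obtain ⟨m, n, hmn, he⟩ := Finite.exists_ne_map_eq_of_infinite
    (fun n : ℕ => (⟨i (f^[n] ∘ γ), hi _ (h1 n).1 _ (h1 n).2⟩ : I))
  wlog hlt : m < n generalizing m n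
  · exact this n m hmn.symm he.symm (by omega)
  have h2 := (hr _ (h1 m).1 _ (h1 n).1 _ _ (h1 m).2 (h1 n).2 (Subtype.ext_iff.1 he)).comp
    (f.symm^[m])
  have hleft : ∀ x, f.symm^[m] (f^[m] x) = x :=
    (Function.LeftInverse.iterate f.symm_apply_apply m)
  refine ⟨n - m, by omega, ?_⟩
  have e1 : f.symm^[m] ∘ f^[m] ∘ γ = γ := funext fun t => hleft _
  have e2 : f.symm^[m] ∘ f^[n] ∘ γ = f^[n - m] ∘ γ := by
    funext t
    simp only [Function.comp_apply]
    conv_lhs => rw [← Nat.add_sub_cancel' hlt.le, Function.iterate_add_apply]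
    exact hleft _
  rwa [e1, e2] at h2

/-! ### Contraction along a separatrix -/

theorem IsProngChart.exists_norm_strictMonoOn (hχ : IsProngChart F G p k χ)
    (hγ : F.IsSeparatrix P p γ) : ∃ b > 0, (∀ t ∈ Ico 0 b, γ t ∈ χ.source) ∧
      StrictMonoOn (fun t => ‖χ (γ t)‖) (Ico 0 b) := by
  obtain ⟨ζ, -, ε, hε, hray⟩ := hχ.exists_startsOnRay hγ
  obtain ⟨ε', hε', hsrc⟩ := hχ.exists_mem_source hγ
  have h0 : ‖χ (γ 0)‖ = 0 := by simp [hγ.start, hχ.map_center]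
  have hpos : ∀ t ∈ Ioo 0 ε', 0 < ‖χ (γ t)‖ := fun t ht =>
    norm_pos_iff.2 (hχ.ne_zero hγ ht.1 (hsrc t ⟨ht.1.le, ht.2⟩))
  refine ⟨min ε ε', lt_min hε hε', fun t ht => hsrc t ⟨ht.1, ht.2.trans_le (min_le_right _ _)⟩, ?_⟩
  intro s hs t ht hst
  have ht1 : t < ε := ht.2.trans_le (min_le_left _ _)
  have ht2 : t < ε' := ht.2.trans_le (min_le_right _ _)
  have ht0 : 0 < t := hs.1.trans_lt hst
  have hc : ContinuousOn (fun t => ‖χ (γ t)‖) (Icc 0 t) :=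
    (hγ.continuousOn_chart hsrc).norm.mono fun r hr => ⟨hr.1, hr.2.trans_lt ht2⟩
  have hinj : InjOn (fun t => ‖χ (γ t)‖) (Icc 0 t) := by
    intro x hx y hy hxy
    simp only at hxy
    rcases hx.1.eq_or_lt with rfl | hx0 <;> rcases hy.1.eq_or_lt with rfl | hy0
    · rfl
    · linarith [hpos y ⟨hy0, hy.2.trans_lt ht2⟩]
    · linarith [hpos x ⟨hx0, hx.2.trans_lt ht2⟩]
    · obtain ⟨sx, rx⟩ := hray x ⟨hx0, hx.2.trans_lt ht1⟩
      obtain ⟨sy, ry⟩ := hray y ⟨hy0, hy.2.trans_lt ht1⟩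
      exact hγ.injOn_Ioi hx0 hy0 (χ.injOn sx sy (by rw [rx, ry, hxy]))
  rcases hc.strictMonoOn_of_injOn_Icc' ht0.le hinj with h | h
  · exact h ⟨hs.1, hst.le⟩ ⟨ht0.le, le_rfl⟩ hst
  · have := h ⟨le_rfl, ht0.le⟩ ⟨ht0.le, le_rfl⟩ ht0
    simp only at this
    linarith [hpos t ⟨ht0, ht2⟩]

/-- Along the beginning of a separatrix of `F`, the function `‖χ ^ k‖ ^ (1 / 2)` is a transverse
coordinate of `G`. -/
theorem IsProngChart.exists_coord_eq_sqrt (hχ : IsProngChart F G p k χ)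
    (hγ : F.IsSeparatrix P p γ) {b : ℝ} (hb : ∀ t ∈ Ico 0 b, γ t ∈ χ.source) {t : ℝ}
    (ht : t ∈ Ioo 0 b) :
    ∃ y, G.IsCoord y (γ t) ∧ ∀ᶠ s in 𝓝 t, y (γ s) = √(‖χ (γ s)‖ ^ k) := by
  obtain ⟨w, hw, -, hG⟩ := hχ.exists_root (γ t) (hb t ⟨ht.1.le, ht.2⟩) (hγ.ne_start ht.1)
  have h1 := (hγ.continuousAt ht.1).eventually hw
  -- As `w ^ 2 = χ ^ k` is real and nonnegative here, `w` is real and `|Re w| = ‖w‖`. The sign of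
  -- `Re w` is locally constant, and changing it is allowed in a coordinate.
  have habs : ∀ᶠ s in 𝓝 t, |(w (γ s)).re| = √(‖χ (γ s)‖ ^ k) := by
    filter_upwards [h1, isOpen_Ioo.mem_nhds ht] with s hs hsb
    have e1 := hχ.pow_eq_norm hγ hb hsb
    rw [← norm_pow, ← Real.sqrt_sq_eq_abs]
    congr 1
    rw [← hs.2] at e1 ⊢
    have e2 := congrArg Complex.re e1
    have e3 : ‖w (γ s) ^ 2‖ = (w (γ s)).re * (w (γ s)).re + (w (γ s)).im * (w (γ s)).im := by
      rw [norm_pow, ← Complex.normSq_eq_norm_sq, Complex.normSq_apply]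
    rw [Complex.ofReal_re, sq (w (γ s)), Complex.mul_re, ← sq (w (γ s))] at e2
    linarith
  have hcont : ContinuousAt (fun s => (w (γ s)).re) t :=
    Complex.continuous_re.continuousAt.comp (h1.self_of_nhds.1.comp (hγ.continuousAt ht.1))
  have hne : (w (γ t)).re ≠ 0 := by
    intro h0
    have := habs.self_of_nhds
    rw [h0, abs_zero] at this
    exact absurd this (Real.sqrt_pos.2 (pow_pos (norm_pos_iff.2
      (hχ.ne_zero hγ ht.1 (hb t ⟨ht.1.le, ht.2⟩))) k)).ne
  rcases hne.lt_or_gt with h | h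
  · refine ⟨fun x => -(w x).re, hG.affine (ε := -1) (c := 0) (Or.inr rfl)
      (Eventually.of_forall fun x => by ring), ?_⟩
    filter_upwards [habs, hcont.eventually (gt_mem_nhds h)] with s hs hs'
    rw [← hs, abs_of_neg hs']
  · refine ⟨fun x => (w x).re, hG, ?_⟩
    filter_upwards [habs, hcont.eventually (lt_mem_nhds h)] with s hs hs'
    rw [← hs, abs_of_pos hs']

/-- The function `R = ‖χ ∘ γ‖ ^ (k / 2)` measures the `G`-distance from `p`. The difference `R ∘ v -
a * R` is locally constant and tends to `0` at the start, so `R (v t) = a * R t < R t`. -/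
theorem IsSeparatrix.param_lt_near_start (hFG : F.Transverse G) (hP : F.sing ⊆ P)
    (hγ : F.IsSeparatrix P p γ) (hf : G.InvariantWithFactor f a) (ha0 : 0 < a) (ha1 : a < 1)
    {v : ℝ → ℝ} (hv : ∀ t > 0, f (γ t) = γ (v t)) (hv0 : ∀ t > 0, 0 < v t)
    (hvm : StrictMonoOn v (Ioi 0)) (hvc : ContinuousOn v (Ioi 0))
    (hv1 : Tendsto v (𝓝[>] 0) (𝓝 0)) : ∃ ε > 0, ∀ t ∈ Ioo 0 ε, v t < t := by
  obtain ⟨k, χ, hχ⟩ := hFG.exists_isProngChart p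
  obtain ⟨b, hb, hsrc, hmono⟩ := hχ.exists_norm_strictMonoOn hγ
  have hk : k ≠ 0 := by have := hχ.one_le; omega
  set R : ℝ → ℝ := fun t => √(‖χ (γ t)‖ ^ k) with hR
  have hRm : StrictMonoOn R (Ico 0 b) := fun s hs t ht hst =>
    Real.sqrt_lt_sqrt (by positivity) (pow_lt_pow_left₀ (hmono hs ht hst) (norm_nonneg _) hk)
  have hR0 : R 0 = 0 := by simp [hR, hγ.start, hχ.map_center, hk]
  have hRlim : Tendsto R (𝓝[>] 0) (𝓝 0) := by
    have h1 : ContinuousOn R (Ico 0 b) :=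
      Real.continuous_sqrt.comp_continuousOn ((hγ.continuousOn_chart hsrc).norm.pow k)
    have := ((h1 0 ⟨le_rfl, hb⟩).mono_of_mem_nhdsWithin
        (Ico_mem_nhdsGE hb)).tendsto.mono_left (nhdsWithin_mono _ Ioi_subset_Ici_self)
    rwa [hR0] at this
  obtain ⟨b', hb', hsub⟩ := mem_nhdsGT_iff_exists_Ioo_subset.1
    ((hv1.eventually (gt_mem_nhds hb)).and (Ioo_mem_nhdsGT hb))
  have hloc : ∀ t ∈ Ioo 0 b', ∀ᶠ s in 𝓝 t, R (v s) - a * R s = R (v t) - a * R t := by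
    intro t ht
    obtain ⟨hvb, -, htb⟩ := hsub ht
    obtain ⟨y₁, hy₁, e₁⟩ := hχ.exists_coord_eq_sqrt hγ hsrc ⟨ht.1, htb⟩
    obtain ⟨y₂, hy₂, e₂⟩ := hχ.exists_coord_eq_sqrt hγ hsrc ⟨hv0 t ht.1, hvb⟩
    have hns : γ t ∉ G.sing := fun h => hγ.notMem ht.1 (hP (hFG.1 ▸ h))
    obtain ⟨ε, c, hε, he⟩ := hy₁.exists_affine (hf.2 (γ t) hns y₂ (by rwa [hv t ht.1]))
    have key : ∀ᶠ s in 𝓝 t, R (v s) = a * (ε * R s + c) := by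
      have hvct : ContinuousAt v t := hvc.continuousAt (Ioi_mem_nhds ht.1)
      filter_upwards [(hγ.continuousAt ht.1).eventually he, e₁, hvct.eventually e₂,
        Ioi_mem_nhds ht.1] with s h1 h2 h3 h4
      rw [h2, hv s h4, h3] at h1
      rw [← h1, mul_inv_cancel_left₀ ha0.ne']
    have hkt := key.self_of_nhds
    -- Both `R` and `R ∘ v` increase, which excludes the sign `-1`.
    have hε1 : ε = 1 := by
      refine hε.resolve_right fun hε => ?_
      have hev : ∀ᶠ s in 𝓝[>] t, R (v s) = a * (ε * R s + c) ∧ s ∈ Ioo t b' :=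
        (key.filter_mono nhdsWithin_le_nhds).and (Ioo_mem_nhdsGT ht.2)
      obtain ⟨s, hs, hst, hsb'⟩ := hev.exists
      have hs0 : 0 < s := ht.1.trans hst
      obtain ⟨hvsb, -, hsb⟩ := hsub ⟨hs0, hsb'⟩
      have l1 : R (v t) < R (v s) :=
        hRm ⟨(hv0 t ht.1).le, hvb⟩ ⟨(hv0 s hs0).le, hvsb⟩ (hvm ht.1 hs0 hst)
      have l2 : R t < R s := hRm ⟨ht.1.le, htb⟩ ⟨hs0.le, hsb⟩ hst
      rw [hs, hkt, hε] at l1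
      nlinarith
    filter_upwards [key] with s hs
    rw [hs, hkt, hε1]; ring
  refine ⟨b', hb', fun t ht => ?_⟩
  have hlim : Tendsto (fun s => R (v s) - a * R s) (𝓝[>] 0) (𝓝 (0 - a * 0)) := by
    have hv2 : Tendsto v (𝓝[>] 0) (𝓝[>] 0) := tendsto_nhdsWithin_iff.2
      ⟨hv1, by filter_upwards [self_mem_nhdsWithin] with s hs using hv0 s hs⟩
    exact (hRlim.comp hv2).sub (hRlim.const_mul a)
  have hconst : Tendsto (fun s => R (v s) - a * R s) (𝓝[>] 0) (𝓝 (R (v t) - a * R t)) := by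
    refine tendsto_const_nhds.congr' ?_
    filter_upwards [Ioo_mem_nhdsGT hb'] with s hs
    exact eq_of_eventually_eq_Ioo (q := fun s => R (v s) - a * R s) hloc ht hs
  have h0 := tendsto_nhds_unique hconst hlim
  obtain ⟨hvb, -, htb⟩ := hsub ht
  have hRt : 0 < R t := hR0 ▸ hRm ⟨le_rfl, hb⟩ ⟨ht.1.le, htb⟩ ht.1
  have hlt : R (v t) < R t := by nlinarith
  exact (hRm.lt_iff_lt ⟨(hv0 t ht.1).le, hvb⟩ ⟨ht.1.le, htb⟩).1 hlt

/-- A fixed point on a separatrix is attracting along the separatrix. -/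
theorem IsSeparatrix.exists_le_param (hFG : F.Transverse G) (hP : F.sing ⊆ P)
    (hγ : F.IsSeparatrix P p γ) (hf : G.InvariantWithFactor f a) (ha0 : 0 < a) (ha1 : a < 1)
    {v : ℝ → ℝ} (hv : ∀ t > 0, f (γ t) = γ (v t)) (hvc : ContinuousOn v (Ioi 0))
    {m : ℝ} (hm : 0 < m) (hvm : v m = m) : ∃ s ∈ Ioo 0 m, s ≤ v s := by
  have hns : γ m ∉ F.sing := fun h => hγ.notMem hm (hP h)
  obtain ⟨χ, hx, hχ⟩ := hFG.2.1 (γ m) hns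
  obtain ⟨hF, hG⟩ := hχ _ hx
  obtain ⟨η, hη, -, hηm, -, -, hY⟩ := hγ.exists_re_monotone hm one_pos hx hF
  obtain ⟨ε, c, hε, he⟩ := hG.exists_affine
    (hf.2 (γ m) (hFG.1 ▸ hns) _ (by rw [hv m hm, hvm]; exact hG))
  have key : ∀ᶠ s in 𝓝 m, (χ (γ (v s))).re = a * (ε * (χ (γ s)).re + c) := by
    filter_upwards [(hγ.continuousAt hm).eventually he, Ioi_mem_nhds hm] with s h1 h2
    rw [hv s h2] at h1
    rw [← h1, mul_inv_cancel_left₀ ha0.ne']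
  have hkm := key.self_of_nhds
  rw [hvm] at hkm
  have hvl : ∀ᶠ s in 𝓝 m, m - η < v s := by
    have : ContinuousAt v m := hvc.continuousAt (Ioi_mem_nhds hm)
    exact this.eventually (lt_mem_nhds (by rw [hvm]; linarith))
  have hev : ∀ᶠ s in 𝓝[<] m, ((χ (γ (v s))).re = a * (ε * (χ (γ s)).re + c) ∧ m - η < v s) ∧
      s ∈ Ioo (m - η) m :=
    ((key.and hvl).filter_mono nhdsWithin_le_nhds).and (Ioo_mem_nhdsLT (by linarith))
  obtain ⟨s, ⟨hs, hvs⟩, hsl, hsr⟩ := hev.exists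
  refine ⟨s, ⟨by linarith, hsr⟩, not_lt.1 fun hlt => ?_⟩
  have m1 : v s ∈ Icc (m - η) (m + η) := ⟨hvs.le, by linarith⟩
  have m2 : s ∈ Icc (m - η) (m + η) := ⟨hsl.le, by linarith⟩
  have m3 : m ∈ Icc (m - η) (m + η) := ⟨by linarith, by linarith⟩
  -- If `v s < s < m`, then `v s` would be farther from the fixed parameter `m` than `s` in the
  -- coordinate `Re χ`, while this coordinate difference is multiplied by `a * ε`, of absolute value
  -- `a < 1`.
  rcases hY with h | h
  · have l1 := h m1 m2 hlt
    have l2 := h m2 m3 hsr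
    simp only at l1 l2
    rcases hε with rfl | rfl <;> nlinarith
  · have l1 := h m1 m2 hlt
    have l2 := h m2 m3 hsr
    simp only at l1 l2
    rcases hε with rfl | rfl <;> nlinarith

/-- A map that contracts the transverse measure of `G` moves the points of a separatrix of `F`
towards its starting point. -/
theorem IsSeparatrix.param_lt (hFG : F.Transverse G) (hP : F.sing ⊆ P)
    (hγ : F.IsSeparatrix P p γ) (hf : G.InvariantWithFactor f a) (ha0 : 0 < a) (ha1 : a < 1)
    {u : Ioi (0 : ℝ) ≃o Ioi (0 : ℝ)} (hu : ∀ t : Ioi (0 : ℝ), f (γ t) = γ (u t))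
    (t : Ioi (0 : ℝ)) : u t < t := by
  set v : ℝ → ℝ := fun t => if h : 0 < t then (u ⟨t, h⟩ : ℝ) else 0 with hvdef
  have hvu : ∀ t (h : 0 < t), v t = u ⟨t, h⟩ := fun t h => dif_pos h
  have hv : ∀ t > 0, f (γ t) = γ (v t) := fun t ht => by rw [hvu t ht]; exact hu ⟨t, ht⟩
  have hv0 : ∀ t > 0, 0 < v t := fun t ht => by rw [hvu t ht]; exact (u _).2
  have hvm : StrictMonoOn v (Ioi 0) := fun s hs t ht hst => by
    rw [hvu s hs, hvu t ht]
    exact u.strictMono (Subtype.mk_lt_mk.2 hst)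
  have hvc : ContinuousOn v (Ioi 0) := by
    rw [continuousOn_iff_continuous_domRestrict]
    refine (continuous_subtype_val.comp u.continuous).congr fun t => ?_
    exact (hvu t t.2).symm
  have hv1 : Tendsto v (𝓝[>] 0) (𝓝 0) := by
    refine tendsto_order.2 ⟨fun c hc => ?_, fun c hc => ?_⟩
    · filter_upwards [self_mem_nhdsWithin] with s hs using hc.trans (hv0 s hs)
    · filter_upwards [Ioo_mem_nhdsGT (u.symm ⟨c, hc⟩).2] with s hs
      rw [hvu s hs.1]
      have : (⟨s, hs.1⟩ : Ioi (0 : ℝ)) < u.symm ⟨c, hc⟩ := hs.2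
      exact u.lt_symm_apply.1 this
  obtain ⟨ε, hε, hnear⟩ := hγ.param_lt_near_start hFG hP hf ha0 ha1 hv hv0 hvm hvc hv1
  by_contra hcon
  have ht0 : (0 : ℝ) < t := t.2
  have hvt : (t : ℝ) ≤ v t := by
    rw [hvu t ht0]; exact_mod_cast not_lt.1 hcon
  have hlow : ∀ s : ℝ, 0 < s → s ≤ v s → ε ≤ s := fun s hs h =>
    not_lt.1 fun h' => (hnear s ⟨hs, h'⟩).not_ge h
  -- The infimum of this set is the first parameter not moved towards the start. By continuity it is
  -- a fixed point of `v`, and all smaller parameters move down, contrary to its being attracting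
  -- from the left.
  have hclosed : IsClosed {s | s ∈ Ici ε ∧ s ≤ v s} :=
    isClosed_Ici.isClosed_le continuousOn_id (hvc.mono fun s hs => hε.trans_le hs)
  have hbdd : BddBelow {s | s ∈ Ici ε ∧ s ≤ v s} := ⟨ε, fun s hs => hs.1⟩
  obtain ⟨hm1, hm2⟩ := hclosed.csInf_mem ⟨(t : ℝ), hlow t ht0 hvt, hvt⟩ hbdd
  set m := sInf {s | s ∈ Ici ε ∧ s ≤ v s} with hmdef
  have hm0 : 0 < m := lt_of_lt_of_le hε hm1
  have hlt : ∀ s ∈ Ioo 0 m, v s < s := fun s hs => not_le.1 fun h =>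
    (csInf_le hbdd ⟨hlow s hs.1 h, h⟩).not_gt hs.2
  have hm3 : v m ≤ m := by
    have h1 : Tendsto v (𝓝[<] m) (𝓝 (v m)) :=
      (hvc.continuousAt (Ioi_mem_nhds hm0)).tendsto.mono_left nhdsWithin_le_nhds
    refine le_of_tendsto_of_tendsto h1 (tendsto_id.mono_left nhdsWithin_le_nhds) ?_
    filter_upwards [Ioo_mem_nhdsLT hm0] with s hs using (hlt s hs).le
  obtain ⟨s, hs, h⟩ := hγ.exists_le_param hFG hP hf ha0 ha1 hv hvc hm0 (le_antisymm hm3 hm2)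
  exact (hlt s hs).not_ge h

end MeasuredFoliation

/-! ### Fundamental domains -/

/-- Otherwise the orbit has a positive infimum `m`. Some iterate lies below `u.symm m > m`, and the
next one lies below `m`. -/
theorem exists_iterate_lt {u : Ioi (0 : ℝ) ≃o Ioi (0 : ℝ)} (hu : ∀ t, u t < t)
    (x c : Ioi (0 : ℝ)) : ∃ n : ℕ, u^[n] x < c := by
  by_contra! hcon
  have hbdd : BddBelow (range fun n : ℕ => ((u^[n] x : Ioi (0 : ℝ)) : ℝ)) :=
    ⟨c, by rintro _ ⟨n, rfl⟩; exact hcon n⟩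
  set m := sInf (range fun n : ℕ => ((u^[n] x : Ioi (0 : ℝ)) : ℝ)) with hm
  have hcm : (c : ℝ) ≤ m := le_csInf (range_nonempty _) (by rintro _ ⟨n, rfl⟩; exact hcon n)
  have hm0 : 0 < m := lt_of_lt_of_le c.2 hcm
  have h1 : (⟨m, hm0⟩ : Ioi (0 : ℝ)) < u.symm ⟨m, hm0⟩ := by
    simpa using hu (u.symm ⟨m, hm0⟩)
  obtain ⟨_, ⟨n, rfl⟩, hn⟩ := exists_lt_of_csInf_lt (range_nonempty _)
    (show m < ((u.symm ⟨m, hm0⟩ : Ioi (0 : ℝ)) : ℝ) from h1)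
  have h2 : u (u^[n] x) < ⟨m, hm0⟩ := u.lt_symm_apply.1 hn
  rw [← Function.iterate_succ_apply' u] at h2
  exact (csInf_le hbdd ⟨n + 1, rfl⟩).not_gt h2

/-- The interval `[u a, a]` is a fundamental domain: from above `a`, stop at the first iterate of
`s` that is `≤ a`; from below, locate `s` between consecutive iterates of `a`. -/
theorem exists_iterate_mem_Icc {u : Ioi (0 : ℝ) ≃o Ioi (0 : ℝ)} (hu : ∀ t, u t < t)
    (a s : Ioi (0 : ℝ)) :
    ∃ (n : ℕ) (s' : Ioi (0 : ℝ)), s' ∈ Icc (u a) a ∧ (u^[n] s = s' ∨ u^[n] s' = s) := by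
  rcases lt_or_ge a s with h | h
  · have hex : ∃ n : ℕ, u^[n] s ≤ a := (exists_iterate_lt hu s a).imp fun n hn => hn.le
    classical
    obtain ⟨m, hm⟩ : ∃ m, Nat.find hex = m + 1 := Nat.exists_eq_succ_of_ne_zero fun h0 => by
      have := Nat.find_spec hex
      rw [h0] at this
      exact this.not_gt h
    refine ⟨m + 1, _, ⟨?_, hm ▸ Nat.find_spec hex⟩, Or.inl rfl⟩
    rw [Function.iterate_succ_apply', u.le_iff_le]
    exact (not_le.1 (Nat.find_min hex (by omega : m < Nat.find hex))).le
  · have hex : ∃ n : ℕ, u^[n] a < s := exists_iterate_lt hu a s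
    classical
    obtain ⟨m, hm⟩ : ∃ m, Nat.find hex = m + 1 := Nat.exists_eq_succ_of_ne_zero fun h0 => by
      have := Nat.find_spec hex
      rw [h0] at this
      exact this.not_ge h
    obtain ⟨s', rfl⟩ := u.surjective.iterate m s
    have h1 : u^[m + 1] a < u^[m] s' := hm ▸ Nat.find_spec hex
    have h2 : u^[m] s' ≤ u^[m] a :=
      not_lt.1 (Nat.find_min hex (by omega : m < Nat.find hex))
    have hmono := u.strictMono.iterate m
    rw [Function.iterate_succ_apply] at h1
    exact ⟨m, s', ⟨(hmono.lt_iff_lt.1 h1).le, hmono.le_iff_le.1 h2⟩, Or.inr rfl⟩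

/-! ### First intersections of two parametrized separatrices -/

/-- The curves `γ` and `δ` meet at the parameters `s` and `t`, and not before. -/
def MeetFirst {X : Type*} (γ δ : ℝ → X) (s t : Ioi (0 : ℝ)) : Prop :=
  γ s = δ t ∧ ∀ s' ≤ s, ∀ t' ≤ t, γ s' = δ t' → s' = s

theorem meetFirst_comp_iff {X : Type*} {γ δ γ' δ' : ℝ → X} {u v : Ioi (0 : ℝ) ≃o Ioi (0 : ℝ)}
    {g : X → X} (hg : Function.Injective g) (hu : ∀ t : Ioi (0 : ℝ), g (γ' t) = γ (u t))
    (hv : ∀ t : Ioi (0 : ℝ), g (δ' t) = δ (v t)) {s t : Ioi (0 : ℝ)} :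
    MeetFirst γ δ (u s) (v t) ↔ MeetFirst γ' δ' s t := by
  have key : ∀ s t : Ioi (0 : ℝ), γ (u s) = δ (v t) ↔ γ' s = δ' t := fun s t => by
    rw [← hu, ← hv, hg.eq_iff]
  refine and_congr (key s t) ⟨fun h s' hs t' ht he => ?_, fun h s' hs t' ht he => ?_⟩
  · exact u.injective (h (u s') (u.le_iff_le.2 hs) (v t') (v.le_iff_le.2 ht) ((key _ _).2 he))
  · obtain ⟨s', rfl⟩ := u.surjective s'
    obtain ⟨t', rfl⟩ := v.surjective t'
    rw [h s' (u.le_iff_le.1 hs) t' (v.le_iff_le.1 ht) ((key _ _).1 he)]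

theorem meetFirst_iterate_iff {X : Type*} {γ δ : ℝ → X} {u v : Ioi (0 : ℝ) ≃o Ioi (0 : ℝ)}
    {g : X → X} (hg : Function.Injective g) (hu : ∀ t : Ioi (0 : ℝ), g (γ t) = γ (u t))
    (hv : ∀ t : Ioi (0 : ℝ), g (δ t) = δ (v t)) (n : ℕ) {s t : Ioi (0 : ℝ)} :
    MeetFirst γ δ (u^[n] s) (v^[n] t) ↔ MeetFirst γ δ s t := by
  induction n with
  | zero => rfl
  | succ n ih =>
    rw [Function.iterate_succ_apply', Function.iterate_succ_apply', meetFirst_comp_iff hg hu hv, ih]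

theorem apply_iterate_param {X : Type*} {γ : ℝ → X} {u : Ioi (0 : ℝ) ≃o Ioi (0 : ℝ)} {g : X → X}
    (hu : ∀ t : Ioi (0 : ℝ), g (γ t) = γ (u t)) (n : ℕ) (t : Ioi (0 : ℝ)) :
    g^[n] (γ t) = γ (u^[n] t) := by
  induction n with
  | zero => rfl
  | succ n ih => rw [Function.iterate_succ_apply', Function.iterate_succ_apply', ih, hu]

namespace MeasuredFoliation

variable {F G : MeasuredFoliation S} {P : Set S} {p q : S} {γ δ : ℝ → S}

/-- Compact pieces of separatrices of transverse foliations meet in finitely many points. -/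
theorem IsSeparatrix.finite_crossings [T2Space S] (hFG : F.Transverse G) (hP : F.sing ⊆ P)
    (hγ : F.IsSeparatrix P p γ) (hδ : G.IsSeparatrix P q δ) (hq : q ∈ P) {s₀ s₁ t₁ : ℝ}
    (hs₀ : 0 < s₀) :
    {x : ℝ × ℝ | x ∈ Icc s₀ s₁ ×ˢ Icc 0 t₁ ∧ γ x.1 = δ x.2}.Finite := by
  by_contra hinf
  have hA : IsCompact (Icc s₀ s₁ ×ˢ Icc 0 t₁) := isCompact_Icc.prod isCompact_Icc
  have hcont : ContinuousOn (fun x : ℝ × ℝ => (γ x.1, δ x.2)) (Icc s₀ s₁ ×ˢ Icc 0 t₁) :=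
    (hγ.continuousOn.comp continuousOn_fst fun x hx => hs₀.le.trans hx.1.1).prodMk
      (hδ.continuousOn.comp continuousOn_snd fun x hx => hx.2.1)
  have hK : IsClosed {x : ℝ × ℝ | x ∈ Icc s₀ s₁ ×ˢ Icc 0 t₁ ∧ γ x.1 = δ x.2} :=
    hcont.preimage_isClosed_of_isClosed hA.isClosed isClosed_diagonal
  obtain ⟨⟨s, t⟩, ⟨hst, he⟩, hacc⟩ := Set.Infinite.exists_accPt_of_subset_isCompact hinf
    (hA.of_isClosed_subset hK fun x hx => hx.1) Subset.rfl
  have hs : 0 < s := hs₀.trans_le hst.1.1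
  -- The limit of crossings cannot be at `q`, which is in `P`, since `γ` avoids `P` at positive
  -- parameters.
  have ht : 0 < t := by
    rcases hst.2.1.eq_or_lt with h | h
    · simp only at he h
      rw [← h, hδ.start] at he
      exact absurd (he ▸ hq) (hγ.notMem hs)
    · exact h
  simp only at he
  obtain ⟨χ, hx, hχ⟩ := hFG.2.1 (γ s) fun h => hγ.notMem hs (hP h)
  have hx' : δ t ∈ χ.source := he ▸ hx
  have e1 : ∀ᶠ s' in 𝓝 s, γ s' ∈ χ.source ∧ (χ (γ s')).im = (χ (γ s)).im ∧ 0 < s' :=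
    ((hγ.continuousAt hs).eventually (χ.open_source.mem_nhds hx)).and
      ((hγ.eventually_coord_eq hs (hχ _ hx).1).and (lt_mem_nhds hs))
  have e2 : ∀ᶠ t' in 𝓝 t, δ t' ∈ χ.source ∧ (χ (δ t')).re = (χ (δ t)).re ∧ 0 < t' :=
    ((hδ.continuousAt ht).eventually (χ.open_source.mem_nhds hx')).and
      ((hδ.eventually_coord_eq ht (hχ _ hx').2).and (lt_mem_nhds ht))
  obtain ⟨⟨s', t'⟩, ⟨hne, -, he'⟩, ⟨h1, h2, h3⟩, h4, h5, h6⟩ :=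
    ((accPt_iff_frequently.1 hacc).and_eventually (e1.prod_nhds e2)).exists
  simp only at he' h1 h2 h3 h4 h5 h6
  -- In the chart a horizontal and a vertical segment share only one point, so no other crossing is
  -- near.
  have hc : χ (γ s') = χ (γ s) := Complex.ext (by rw [he', h5, he]) h2
  have hss : s' = s := hγ.injOn_Ioi h3 hs (χ.injOn h1 hx hc)
  have htt : t' = t := hδ.injOn_Ioi h6 ht (by rw [← he', hss, he])
  exact hne (by rw [hss, htt])

theorem IsSeparatrix.finite_meetFirst [T2Space S] (hFG : F.Transverse G) (hP : F.sing ⊆ P)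
    (hγ : F.IsSeparatrix P p γ) (hδ : G.IsSeparatrix P q δ) (hq : q ∈ P) {g : S → S}
    (hg : Function.Injective g) {u v : Ioi (0 : ℝ) ≃o Ioi (0 : ℝ)}
    (hu : ∀ t : Ioi (0 : ℝ), g (γ t) = γ (u t)) (hv : ∀ t : Ioi (0 : ℝ), g (δ t) = δ (v t))
    (hlt : ∀ t, u t < t) :
    ∃ Z : Set S, Z.Finite ∧ ∀ s t, MeetFirst γ δ s t →
      ∃ n : ℕ, ∃ z ∈ Z, g^[n] (γ s) = z ∨ g^[n] z = γ s := by
  by_cases hex : ∃ a b, MeetFirst γ δ a b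
  · obtain ⟨a, b, hab⟩ := hex
    refine ⟨_, (hγ.finite_crossings hFG hP hδ hq (s₀ := u a) (s₁ := a) (t₁ := v b) (u a).2).image
      (fun x => γ x.1), fun s t hst => ?_⟩
    have hmem : ∀ s' t', s' ∈ Icc (u a) a → MeetFirst γ δ s' t' → γ s' ∈ (fun x : ℝ × ℝ => γ x.1) ''
        {x : ℝ × ℝ | x ∈ Icc (u a : ℝ) a ×ˢ Icc 0 (v b : ℝ) ∧ γ x.1 = δ x.2} := by
      intro s' t' hs' hf
      -- Otherwise the meeting at `(u a, v b)` precedes the one at `(s', t')`; even when `s' = u a`,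
      -- injectivity of `δ` gives a contradiction.
      have hle : t' ≤ v b := by
        by_contra! hlt'
        have e1 : γ (u a) = δ (v b) := ((meetFirst_comp_iff hg hu hv).2 hab).1
        have e2 := hf.2 (u a) hs'.1 (v b) hlt'.le e1
        rw [e2, hf.1] at e1
        exact hlt'.ne' (Subtype.ext (hδ.injOn_Ioi t'.2 (v b).2 e1))
      exact ⟨(s', t'), ⟨⟨hs', le_of_lt t'.2, hle⟩, hf.1⟩, rfl⟩
    obtain ⟨n, s', hs', h | h⟩ := exists_iterate_mem_Icc hlt a s
    · refine ⟨n, γ s', hmem s' (v^[n] t) hs' ?_, Or.inl ?_⟩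
      · rw [← h, meetFirst_iterate_iff hg hu hv]; exact hst
      · rw [apply_iterate_param hu, h]
    · obtain ⟨t', rfl⟩ := v.surjective.iterate n t
      refine ⟨n, γ s', hmem s' t' hs' ?_, Or.inr ?_⟩
      · rw [← h, meetFirst_iterate_iff hg hu hv] at hst; exact hst
      · rw [apply_iterate_param hu, h]
  · push Not at hex
    exact ⟨∅, finite_empty, fun s t h => absurd h (hex s t)⟩

end MeasuredFoliation

/-! ### Orbits -/

theorem coe_pow_eq_iterate (f : S ≃ₜ S) (n : ℕ) : ⇑(f ^ n) = f^[n] := by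
  induction n with
  | zero => rfl
  | succ n ih =>
    rw [pow_succ, Function.iterate_succ, ← ih]; rfl

theorem fullOrbit_apply (f : S ≃ₜ S) (x : S) : fullOrbit f (f x) = fullOrbit f x := by
  ext y
  constructor
  · rintro ⟨n, rfl⟩
    exact ⟨n + 1, by simp [zpow_add]⟩
  · rintro ⟨n, rfl⟩
    exact ⟨n - 1, by simp [zpow_sub]⟩

theorem fullOrbit_iterate (f : S ≃ₜ S) (n : ℕ) (x : S) :
    fullOrbit f (f^[n] x) = fullOrbit f x := by
  induction n with
  | zero => rfl
  | succ n ih => rw [Function.iterate_succ_apply', fullOrbit_apply, ih]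

/-! ### Finiteness -/

theorem IsSingSet.sing_subset {f : S ≃ₜ S} {F : MeasuredFoliation S} {P : Set S}
    (hP : IsSingSet f F P) : F.sing ⊆ P := fun x hx => by
  rw [hP.1 ⟨x, hx⟩]; exact hx

theorem IsSingSet.finite [CompactSpace S] {f : S ≃ₜ S} {F G : MeasuredFoliation S} {P : Set S}
    (hFG : F.Transverse G) (hP : IsSingSet f F P) : P.Finite := by
  rcases F.sing.eq_empty_or_nonempty with h | h
  · exact (hP.2 h).1
  · rw [hP.1 h]; exact hFG.finite_sing

/-- Chosen periodic points need not form an `f`-invariant set, but a common multiple of their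
periods fixes each of them. -/
theorem IsSingSet.exists_iterate_mem_iff {f : S ≃ₜ S} {F : MeasuredFoliation S} {P : Set S}
    (hP : IsSingSet f F P) (hf : ∀ x, f x ∈ F.sing ↔ x ∈ F.sing) :
    ∃ N : ℕ, 0 < N ∧ ∀ x, (f ^ N) x ∈ P ↔ x ∈ P := by
  rcases F.sing.eq_empty_or_nonempty with h | h
  · obtain ⟨hfin, hper⟩ := hP.2 h
    refine ⟨∏ p ∈ hfin.toFinset, Function.minimalPeriod f p, Finset.prod_pos fun p hp =>
      Function.minimalPeriod_pos_of_mem_periodicPts (hper p (hfin.mem_toFinset.1 hp)), ?_⟩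
    have hfix : ∀ p ∈ P, (f ^ (∏ p ∈ hfin.toFinset, Function.minimalPeriod f p)) p = p := by
      intro p hp
      rw [coe_pow_eq_iterate]
      exact (Function.isPeriodicPt_minimalPeriod f p).trans_dvd
        (Finset.dvd_prod_of_mem _ (hfin.mem_toFinset.2 hp))
    refine fun x => ⟨fun hx => ?_, fun hx => by rwa [hfix x hx]⟩
    have := (f ^ (∏ p ∈ hfin.toFinset, Function.minimalPeriod f p)).injective (hfix _ hx)
    rwa [this] at hx
  · refine ⟨1, one_pos, fun x => ?_⟩
    rw [hP.1 h, pow_one]; exact hf x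

theorem IsPseudoAnosov.finite_orbits_of_pair [T2Space S] [CompactSpace S] [ChartedSpace ℂ S]
    {f : S ≃ₜ S} {Fs Fu : MeasuredFoliation S} {lam : ℝ} (hf : IsPseudoAnosov f Fs Fu lam)
    {P : Set S} (hP : IsSingSet f Fs P) {p q : S} (hp : p ∈ P) (hq : q ∈ P) {γ δ : ℝ → S}
    (hγ : Fs.IsSeparatrix P p γ) (hδ : Fu.IsSeparatrix P q δ) :
    {O : Set S | ∃ γ' δ' s t, Reparam γ γ' ∧ Reparam δ δ' ∧ MeetFirst γ' δ' s t ∧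
      O = fullOrbit f (γ' s)}.Finite := by
  have hT := hf.transverse
  have hPfin := hP.finite hT
  have hPs := hP.sing_subset
  have hPu : Fu.sing ⊆ P := hT.1 ▸ hPs
  have hlam : 0 < lam := one_pos.trans hf.one_lt
  obtain ⟨N, hN, hNP⟩ := hP.exists_iterate_mem_iff hf.stable.1
  obtain ⟨m, hm, rm⟩ := hγ.exists_reparam_iterate hT hPs hPfin (hf.stable.pow N)
    (pow_ne_zero N hlam.ne') hNP hp
  obtain ⟨n, hn, rn⟩ := hδ.exists_reparam_iterate hT.symm hPu hPfin (hf.unstable.pow N)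
    (pow_ne_zero N (inv_ne_zero hlam.ne')) hNP hq
  have h1 : Reparam γ (⇑(f ^ (N * (m * n))) ∘ γ) := by
    have := rm.iterate n
    rwa [← Function.iterate_mul, ← coe_pow_eq_iterate, ← pow_mul] at this
  have h2 : Reparam δ (⇑(f ^ (N * (m * n))) ∘ δ) := by
    have := rn.iterate m
    rwa [← Function.iterate_mul, ← coe_pow_eq_iterate, ← pow_mul, mul_comm n m] at this
  obtain ⟨u, hu⟩ := h1
  obtain ⟨v, hv⟩ := h2
  have hpos : N * (m * n) ≠ 0 := by positivity
  -- Length along a stable leaf is measured by `Fu`, whose factor `lam⁻¹` is less than one.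
  have hlt := hγ.param_lt hT hPs (hf.unstable.pow (N * (m * n)))
    (pow_pos (inv_pos.2 hlam) _)
    (pow_lt_one₀ (inv_pos.2 hlam).le (inv_lt_one_of_one_lt₀ hf.one_lt) hpos) hu
  obtain ⟨Z, hZ, hZm⟩ := hγ.finite_meetFirst hT hPs hδ hq (f ^ (N * (m * n))).injective hu hv hlt
  refine (hZ.image (fullOrbit f)).subset ?_
  rintro O ⟨γ', δ', s, t, ⟨u', hu'⟩, ⟨v', hv'⟩, hfirst, rfl⟩
  obtain ⟨k, z, hz, h⟩ := hZm (u' s) (v' t)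
    ((meetFirst_comp_iff (g := id) Function.injective_id hu' hv').2 hfirst)
  rw [coe_pow_eq_iterate, ← Function.iterate_mul, ← hu'] at h
  refine ⟨z, hz, ?_⟩
  rcases h with h | h
  · rw [← h, fullOrbit_iterate]
  · rw [← h, fullOrbit_iterate]

end PA
end

theorem mainTheorem6 {S : Type*} [TopologicalSpace S] [T2Space S] [CompactSpace S]
    [ChartedSpace ℂ S] [PA.OrientedSurface S] (f : S ≃ₜ S) (Fs Fu : PA.MeasuredFoliation S)
    (lam : ℝ) (hf : PA.IsPseudoAnosov f Fs Fu lam) (P : Set S) (hP : PA.IsSingSet f Fs P) :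
    {O : Set S | ∃ z, PA.IsFirstIntersectionPoint Fs Fu P z ∧ O = PA.fullOrbit f z}.Finite := by
  have hT := hf.transverse
  have hPfin := hP.finite hT
  have hPu : Fu.sing ⊆ P := hT.1 ▸ hP.sing_subset
  obtain ⟨I, i, hI, hi, ri⟩ := hT.exists_finite_classes hP.sing_subset hPfin
  obtain ⟨J, j, hJ, hj, rj⟩ := hT.symm.exists_finite_classes hPu hPfin
  have hsub : {O : Set S | ∃ z, PA.IsFirstIntersectionPoint Fs Fu P z ∧ O = PA.fullOrbit f z} ⊆
      ⋃ α ∈ I, ⋃ β ∈ J, {O : Set S | ∃ p ∈ P, ∃ q ∈ P, ∃ γ δ s t, Fs.IsSeparatrix P p γ ∧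
        Fu.IsSeparatrix P q δ ∧ i γ = α ∧ j δ = β ∧ PA.MeetFirst γ δ s t ∧
        O = PA.fullOrbit f (γ s)} := by
    rintro O ⟨z, ⟨-, p, hp, q, hq, γ, δ, hγ, hδ, s, hs, t, ht, hsz, htz, hfirst⟩, rfl⟩
    refine mem_biUnion (hi p hp γ hγ) (mem_biUnion (hj q hq δ hδ) ⟨p, hp, q, hq, γ, δ,
      ⟨s, hs⟩, ⟨t, ht⟩, hγ, hδ, rfl, rfl, ⟨hsz.trans htz.symm, ?_⟩, by rw [hsz]⟩)
    intro s' hs' t' ht' he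
    have hmem : γ s' ∈ γ '' Ioc 0 s ∩ δ '' Ioc 0 t :=
      ⟨⟨s', ⟨s'.2, hs'⟩, rfl⟩, ⟨t', ⟨t'.2, ht'⟩, he.symm⟩⟩
    rw [hfirst] at hmem
    exact Subtype.ext (hγ.injOn_Ioi s'.2 hs (hmem.trans hsz.symm))
  refine Finite.subset (hI.biUnion fun α _ => hJ.biUnion fun β _ => ?_) hsub
  -- Any pair in these two classes serves as representative for all the others.
  by_cases hex : ∃ p ∈ P, ∃ q ∈ P, ∃ γ δ, Fs.IsSeparatrix P p γ ∧ Fu.IsSeparatrix P q δ ∧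
      i γ = α ∧ j δ = β
  · obtain ⟨p, hp, q, hq, γ, δ, hγ, hδ, rfl, rfl⟩ := hex
    refine (hf.finite_orbits_of_pair hP hp hq hγ hδ).subset ?_
    rintro O ⟨p', hp', q', hq', γ', δ', s, t, hγ', hδ', hα, hβ, hfirst, rfl⟩
    exact ⟨γ', δ', s, t, ri p hp p' hp' γ γ' hγ hγ' hα.symm,
      rj q hq q' hq' δ δ' hδ hδ' hβ.symm, hfirst, rfl⟩
  · refine finite_empty.subset ?_
    rintro O ⟨p, hp, q, hq, γ, δ, -, -, hγ, hδ, hα, hβ, -, -⟩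
    exact hex ⟨p, hp, q, hq, γ, δ, hγ, hδ, hα, hβ⟩
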